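/- Let $\theta\in\mathbb R$ with $e^{i\theta}\neq 1$ and let $U_\theta=\mathrm{diag}(1,1,1,e^{i\theta})$ on two qubits (one held by Alice, one by Bob). An $n$-turn LOCC protocol consists of $n$ turns; at each turn one party performs a generalized measurement on its own system, given by finitely many operators $M^{(r)}$ with $\sum_r M^{(r)\dagger}M^{(r)}=\mathbb I$ (the dimension of the system may change), and announces the outcome; everything later may depend on the earlier outcomes, and after the last turn each party holds one qubit. For a sequence $R$ of outcomes of the first turns, the accumulated operators $A^{R}$, $B^{R}$ are the products of Alice's, respectively Bob's, measurement operators along $R$. Assisted by a normalized resource vector $\psi\in\mathbb C^p\otimes\mathbb C^q$ shared by Alice and Bob, the protocol (deterministically) implements $U_\theta$ if for every two-qubit input state $\rho$ $$\sum_{R}(A^{R}\otimes B^{R})(\rho\otimes|\psi\rangle\langle\psi|)(A^{R}\otimes B^{R})^\dagger=U_\theta\,\rho\,U_\theta^\dagger ,$$ where $R$ runs over the complete outcome sequences. The Schmidt number of $\psi$ is the number of nonzero coefficients of its Schmidt decomposition. (1) Let $p=q=2$, let $\psi$ have Schmidt number 2, and let an $n$-turn protocol implement $U_\theta$ with resource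 $\psi$. Let $R$ be a sequence of outcomes of the first $n-3$ turns after which the last three turns are Bob's, Alice's and Bob's, with accumulated operators $A$, $B$, and let $A_{00}=\sqrt{\langle 0|A^\dagger A|0\rangle}$ and $B_{00}=\sqrt{\langle 0|B^\dagger B|0\rangle}$, where $|0\rangle$ is the basis state of the party's input qubit; these are operators on the party's resource qubit. Say that a measurement $\{M^{(r)}\}$ acts on the range of an operator $C$ as a random unitary operation if there are probabilities $w_r$ with $\sum_r w_r=1$ and operators $V_r$ with $M^{(r)}C=\sqrt{w_r}\,V_rC$ for all $r$, where $V_r$ preserves inner products on the range of $C$ whenever $w_r\ne0$. (a) If $\operatorname{rank}A_{00}=1$, then, after every outcome of Bob's next turn for which the resulting branch has nonzero probability, Alice's measurement at turn $n-1$ acts on the range of $A$ as a random unitary operation. (b) If $\operatorname{rank}B_{00}=1$ and the branch $R$ has nonzero probability, then Bob's measurement at turn $n-2$ acts on the range of $B$ as a random unitary operation. (c) If $\operatorname{rank}A_{00}=\operatorname{rank}B_{00}=2$, then the last three turns after $R$ can be replaced by three turns performed by Alice, Bob, Alice (the first $n-3$ turns being unchanged), such that for every input state the (unnormalized) output obtained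 from the branch $R$ is the same. (2) Let $p,q$ be arbitrary, let $\psi$ have Schmidt number 2, and let an $n$-turn protocol implement $U_\theta$ with resource $\psi$. If $n>3$, then there is an $(n-1)$-turn protocol that coincides with the given one during the first $n-4$ turns and implements $U_\theta$ with the same resource $\psi$. Moreover (for every $n$) there is a three-turn protocol, with the parties acting in the order Alice, Bob, Alice or Bob, Alice, Bob, that implements $U_\theta$ with the resource $\psi$. -/

import Mathlib

open scoped Matrix Kronecker MatrixOrder ComplexOrder

namespace LOCC

inductive Party
  | alice
  | bob

/-- Two-party LOCC protocols with `n` turns in every branch, for local systems of (current)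
dimensions `a` (first party, Alice) and `b` (second party, Bob).  At each turn one party performs a
generalized measurement, given by measurement operators `M i` with `∑ i, (M i)† (M i) = 1`, and
announces the outcome `i`; everything that follows may depend on it, including who acts next.
The operators may change the dimension of the local system (ancillas, discarding).  After the last
turn each party is left with one qubit, the output.  A trivial turn is the one-outcome
measurement `1`. -/
inductive Protocol : ℕ → ℕ → ℕ → Type
  | done : Protocol 0 2 2
  | alice {n a b : ℕ} (r : ℕ) (d : Fin r → ℕ) (M : ∀ i, Matrix (Fin (d i)) (Fin a) ℂ)
      (complete : ∑ i, (M i)ᴴ * M i = 1) (next : ∀ i, Protocol n (d i) b) : Protocol (n + 1) a b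
  | bob {n a b : ℕ} (r : ℕ) (d : Fin r → ℕ) (K : ∀ i, Matrix (Fin (d i)) (Fin b) ℂ)
      (complete : ∑ i, (K i)ᴴ * K i = 1) (next : ∀ i, Protocol n a (d i)) : Protocol (n + 1) a b

/-- The completely positive trace-preserving map that a protocol performs. -/
noncomputable def Protocol.run : {n a b : ℕ} → Protocol n a b →
    Matrix (Fin a × Fin b) (Fin a × Fin b) ℂ → Matrix (Fin 2 × Fin 2) (Fin 2 × Fin 2) ℂ
  | _, _, _, .done, σ => σ
  | _, _, b, .alice _ _ M _ next, σ =>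
      ∑ i, (next i).run
        ((M i ⊗ₖ (1 : Matrix (Fin b) (Fin b) ℂ)) * σ * (M i ⊗ₖ (1 : Matrix (Fin b) (Fin b) ℂ))ᴴ)
  | _, a, _, .bob _ _ K _ next, σ =>
      ∑ i, (next i).run
        (((1 : Matrix (Fin a) (Fin a) ℂ) ⊗ₖ K i) * σ * ((1 : Matrix (Fin a) (Fin a) ℂ) ⊗ₖ K i)ᴴ)

/-- In every branch the acting parties are, in order, those of the list. -/
def Protocol.Follows : {n a b : ℕ} → Protocol n a b → List Party → Prop
  | _, _, _, .done, s => s = []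
  | _, _, _, .alice _ _ _ _ next, s => ∃ t, s = Party.alice :: t ∧ ∀ i, (next i).Follows t
  | _, _, _, .bob _ _ _ _ next, s => ∃ t, s = Party.bob :: t ∧ ∀ i, (next i).Follows t

/-- `Q.IsNode P A B`: some sequence of outcomes of the first turns of `P` leads to the remaining
protocol `Q`, and `A`, `B` are the accumulated operators (the products of the measurement operators
along that sequence) of Alice and Bob. -/
inductive Protocol.IsNode {m a' b' : ℕ} (Q : Protocol m a' b') : {n a b : ℕ} → Protocol n a b →
    Matrix (Fin a') (Fin a) ℂ → Matrix (Fin b') (Fin b) ℂ → Prop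
  | here : IsNode Q Q 1 1
  | alice {n a b r : ℕ} {d : Fin r → ℕ} {M : ∀ i, Matrix (Fin (d i)) (Fin a) ℂ}
      {complete : ∑ i, (M i)ᴴ * M i = 1} {next : ∀ i, Protocol n (d i) b} (i : Fin r)
      {A : Matrix (Fin a') (Fin (d i)) ℂ} {B : Matrix (Fin b') (Fin b) ℂ}
      (h : IsNode Q (next i) A B) : IsNode Q (Protocol.alice r d M complete next) (A * M i) B
  | bob {n a b r : ℕ} {d : Fin r → ℕ} {K : ∀ i, Matrix (Fin (d i)) (Fin b) ℂ}
      {complete : ∑ i, (K i)ᴴ * K i = 1} {next : ∀ i, Protocol n a (d i)} (i : Fin r)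
      {A : Matrix (Fin a') (Fin a) ℂ} {B : Matrix (Fin b') (Fin (d i)) ℂ}
      (h : IsNode Q (next i) A B) : IsNode Q (Protocol.bob r d K complete next) A (B * K i)

/-- The two protocols coincide during their first `k` turns. -/
inductive Protocol.SameFirst : ℕ → {n n' a b : ℕ} → Protocol n a b → Protocol n' a b → Prop
  | zero {n n' a b : ℕ} (P : Protocol n a b) (P' : Protocol n' a b) : SameFirst 0 P P'
  | alice {k n n' a b r : ℕ} {d : Fin r → ℕ} {M : ∀ i, Matrix (Fin (d i)) (Fin a) ℂ}
      {complete : ∑ i, (M i)ᴴ * M i = 1} {next : ∀ i, Protocol n (d i) b}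
      {next' : ∀ i, Protocol n' (d i) b} (h : ∀ i, SameFirst k (next i) (next' i)) :
      SameFirst (k + 1) (Protocol.alice r d M complete next) (Protocol.alice r d M complete next')
  | bob {k n n' a b r : ℕ} {d : Fin r → ℕ} {K : ∀ i, Matrix (Fin (d i)) (Fin b) ℂ}
      {complete : ∑ i, (K i)ᴴ * K i = 1} {next : ∀ i, Protocol n a (d i)}
      {next' : ∀ i, Protocol n' a (d i)} (h : ∀ i, SameFirst k (next i) (next' i)) :
      SameFirst (k + 1) (Protocol.bob r d K complete next) (Protocol.bob r d K complete next')

/-- Density matrices. -/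
def IsState {ι : Type} [Fintype ι] (ρ : Matrix ι ι ℂ) : Prop :=
  ρ.PosSemidef ∧ ρ.trace = 1

/-- `ψ` is a normalized vector of `ℂ^p ⊗ ℂ^q` whose Schmidt decomposition has exactly `r` nonzero
coefficients. -/
def IsPureStateOfSchmidtNumber {p q : ℕ} (r : ℕ) (ψ : EuclideanSpace ℂ (Fin p × Fin q)) : Prop :=
  ‖ψ‖ = 1 ∧ ∃ (s : Fin r → ℝ) (e : Fin r → EuclideanSpace ℂ (Fin p))
    (f : Fin r → EuclideanSpace ℂ (Fin q)),
    (∀ i, 0 < s i) ∧ Orthonormal ℂ e ∧ Orthonormal ℂ f ∧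
      ∀ k l, ψ (k, l) = ∑ i, (s i : ℂ) * e i k * f i l

/-- The two-qubit gate `diag (1, 1, 1, e^{iθ})`. -/
noncomputable def gate (θ : ℝ) : Matrix (Fin 2 × Fin 2) (Fin 2 × Fin 2) ℂ :=
  Matrix.diagonal fun ij => if ij = (1, 1) then Complex.exp (θ * Complex.I) else 1

/-- The state `ρ ⊗ |ψ⟩⟨ψ|` of input and resource, with Alice's system (input qubit and her part
of the resource) and Bob's system grouped together: `ℂ² ⊗ ℂ^p` and `ℂ² ⊗ ℂ^q`. -/
noncomputable def joint {p q : ℕ} (ρ : Matrix (Fin 2 × Fin 2) (Fin 2 × Fin 2) ℂ)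
    (ψ : EuclideanSpace ℂ (Fin p × Fin q)) :
    Matrix (Fin (2 * p) × Fin (2 * q)) (Fin (2 * p) × Fin (2 * q)) ℂ :=
  fun x y =>
    let α := finProdFinEquiv.symm x.1
    let β := finProdFinEquiv.symm x.2
    let α' := finProdFinEquiv.symm y.1
    let β' := finProdFinEquiv.symm y.2
    ρ (α.1, β.1) (α'.1, β'.1) * (ψ (α.2, β.2) * star (ψ (α'.2, β'.2)))

/-- The protocol, assisted by the resource `ψ`, deterministically implements `U` on all (unknown)
two-qubit input states. -/
def Protocol.Implements {n p q : ℕ} (P : Protocol n (2 * p) (2 * q))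
    (ψ : EuclideanSpace ℂ (Fin p × Fin q)) (U : Matrix (Fin 2 × Fin 2) (Fin 2 × Fin 2) ℂ) : Prop :=
  ∀ ρ, IsState ρ → P.run (joint ρ ψ) = U * ρ * Uᴴ

/-- The unnormalized state, for the input `ρ`, of a branch with accumulated operators `A`, `B`. -/
noncomputable def branchState {p q a b : ℕ} (ψ : EuclideanSpace ℂ (Fin p × Fin q))
    (A : Matrix (Fin a) (Fin (2 * p)) ℂ) (B : Matrix (Fin b) (Fin (2 * q)) ℂ)
    (ρ : Matrix (Fin 2 × Fin 2) (Fin 2 × Fin 2) ℂ) : Matrix (Fin a × Fin b) (Fin a × Fin b) ℂ :=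
  (A ⊗ₖ B) * joint ρ ψ * (A ⊗ₖ B)ᴴ

/-- The branch with accumulated operators `A`, `B` has positive probability for some input. -/
def Occurs {p q a b : ℕ} (ψ : EuclideanSpace ℂ (Fin p × Fin q))
    (A : Matrix (Fin a) (Fin (2 * p)) ℂ) (B : Matrix (Fin b) (Fin (2 * q)) ℂ) : Prop :=
  ∃ ρ, IsState ρ ∧ branchState ψ A B ρ ≠ 0

/-- The positive square root of the block `⟨k| A†A |k⟩` of `A†A`, where `|k⟩` belongs to the input
qubit; an operator on the party's part `ℂ^p` of the resource. -/
noncomputable def block {a p : ℕ} (A : Matrix (Fin a) (Fin (2 * p)) ℂ) (k : Fin 2) :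
    Matrix (Fin p) (Fin p) ℂ :=
  CFC.sqrt ((Aᴴ * A).submatrix (fun x => finProdFinEquiv (k, x)) (fun x => finProdFinEquiv (k, x)))

/-- On the range of the accumulated operator `A`, the measurement `M` acts as a random unitary
operation: outcome `i` has a probability `w i` that does not depend on the state, and the operator
applied then is `√(w i) • V i` with `V i` preserving inner products on the range of `A`. -/
def ActsAsRandomUnitary {r a c : ℕ} {d : Fin r → ℕ} (M : ∀ i, Matrix (Fin (d i)) (Fin a) ℂ)
    (A : Matrix (Fin a) (Fin c) ℂ) : Prop :=
  ∃ (w : Fin r → ℝ) (V : ∀ i, Matrix (Fin (d i)) (Fin a) ℂ),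
    (∀ i, 0 ≤ w i) ∧ ∑ i, w i = 1 ∧ (∀ i, M i * A = ((√(w i) : ℝ) : ℂ) • (V i * A)) ∧
      ∀ i, w i ≠ 0 → (V i * A)ᴴ * (V i * A) = Aᴴ * A

end LOCC

namespace LOCC

open Matrix

/-! ### Kraus form of a protocol -/

/-! A unitary channel is extreme among completely positive maps, so every branch of a protocol
implementing the gate acts on the input as a multiple of the gate (`exists_eq_smul_of_kraus`). A
resource of Schmidt number two is a sum of two product terms, so a branch is described by two-column
matrices `A i`, `B k`, one for each local input basis state; the unnormalized output for |i⟩|k⟩ is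
`A i * (B k)ᵀ`. At a leaf, inverting the phase table (1, 1; 1, e) gives the relations `Balanced`
between the Gram matrices P of Alice and Q of Bob. They are linear in the products PᵀQ and the
weight, and these products add up over branches (`contract_kraus`), so they hold at every node
(`Protocol.Realizes.balanced`).

The random-unitary claims: at nonzero weight the off-diagonal Gram blocks vanish. If Q 0 0 has rank
one, a further operator of that party can only rescale it; the trace relation fixes the factor, and
the quadratic relation forces the same factor on Q 1 1 (`Balanced.gram_mul_eq`).

The reduction of turns: `Balanced` alone suffices to finish in the order Alice, Bob, Alice
(`Balanced.exists_protocol`). P 0 0 splits into two rank-one parts on which the forms Q 0 0 and Q 1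
1 agree (`exists_neutral_split`). As these forms have equal determinants (`Balanced.det_eq`), each
part has a partner vector whose cross terms under the two forms differ by the factor e
(`partner_form`, `Balanced.exists_split`). Alice's first measurement produces these parts. In the
resulting basis Bob's Gram matrices split into rank-one parts of unit relative phase
(`exists_phase_split`); Bob's outcome then leaves the gate up to diag(1, μ) on Alice's qubit, which
she undoes. Trace preservation fixes the total weight (`weight_unique`), so this ending fits any
node: the last three turns, the last four, or the whole protocol. -/

theorem sum_kronecker {ι l m n o : Type*} [Fintype ι] (f : ι → Matrix l m ℂ)
    (N : Matrix n o ℂ) : (∑ i, f i) ⊗ₖ N = ∑ i, f i ⊗ₖ N := by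
  ext
  simp [Matrix.sum_apply, Finset.sum_mul]

theorem kronecker_sum {ι l m n o : Type*} [Fintype ι] (N : Matrix l m ℂ)
    (f : ι → Matrix n o ℂ) : N ⊗ₖ (∑ i, f i) = ∑ i, N ⊗ₖ f i := by
  ext
  simp [Matrix.sum_apply, Finset.mul_sum]

/-- Flattening the outcome tree keeps the Kraus operators products X ⊗ Y. The product form and the
completeness relation are all that is used later about the tree below a node. -/
theorem Protocol.exists_kraus {n a b : ℕ} (P : Protocol n a b) :
    ∃ (ι : Type) (_ : Fintype ι) (X : ι → Matrix (Fin 2) (Fin a) ℂ)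
      (Y : ι → Matrix (Fin 2) (Fin b) ℂ),
      (∀ σ, P.run σ = ∑ s, (X s ⊗ₖ Y s) * σ * (X s ⊗ₖ Y s)ᴴ) ∧
        ∑ s, ((X s)ᴴ * X s) ⊗ₖ ((Y s)ᴴ * Y s) = 1 := by
  induction P with
  | done => exact ⟨Unit, inferInstance, fun _ => 1, fun _ => 1, by simp [Protocol.run], by simp⟩
  | @alice n a b r d M complete next ih =>
    choose ι hι X Y hrun hsum using ih
    refine ⟨Σ i, ι i, inferInstance, fun s => X s.1 s.2 * M s.1, fun s => Y s.1 s.2, ?_, ?_⟩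
    · intro σ
      simp only [Protocol.run, hrun, Fintype.sum_sigma]
      refine Finset.sum_congr rfl fun i _ => Finset.sum_congr rfl fun s _ => ?_
      have : (X i s * M i) ⊗ₖ Y i s = (X i s ⊗ₖ Y i s) * (M i ⊗ₖ (1 : Matrix (Fin b) (Fin b) ℂ)) := by
        rw [← mul_kronecker_mul, Matrix.mul_one]
      rw [this, conjTranspose_mul]
      simp only [Matrix.mul_assoc]
    · rw [Fintype.sum_sigma]
      have h : ∀ i, ∑ s, ((X i s * M i)ᴴ * (X i s * M i)) ⊗ₖ ((Y i s)ᴴ * Y i s)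
          = ((M i)ᴴ * M i) ⊗ₖ (1 : Matrix (Fin b) (Fin b) ℂ) := by
        intro i
        have : ∀ s, ((X i s * M i)ᴴ * (X i s * M i)) ⊗ₖ ((Y i s)ᴴ * Y i s)
            = ((M i)ᴴ ⊗ₖ (1 : Matrix (Fin b) (Fin b) ℂ)) *
              (((X i s)ᴴ * X i s) ⊗ₖ ((Y i s)ᴴ * Y i s)) * (M i ⊗ₖ (1 : Matrix (Fin b) (Fin b) ℂ)) := by
          intro s
          rw [← mul_kronecker_mul, ← mul_kronecker_mul, conjTranspose_mul]
          simp only [Matrix.mul_assoc, Matrix.mul_one, Matrix.one_mul]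
        simp only [this]
        rw [← Matrix.sum_mul, ← Matrix.mul_sum, hsum, Matrix.mul_one, ← mul_kronecker_mul,
          Matrix.mul_one]
      simp only [h]
      rw [← sum_kronecker, complete, one_kronecker_one]
  | @bob n a b r d K complete next ih =>
    choose ι hι X Y hrun hsum using ih
    refine ⟨Σ i, ι i, inferInstance, fun s => X s.1 s.2, fun s => Y s.1 s.2 * K s.1, ?_, ?_⟩
    · intro σ
      simp only [Protocol.run, hrun, Fintype.sum_sigma]
      refine Finset.sum_congr rfl fun i _ => Finset.sum_congr rfl fun s _ => ?_
      have : X i s ⊗ₖ (Y i s * K i) = (X i s ⊗ₖ Y i s) * ((1 : Matrix (Fin a) (Fin a) ℂ) ⊗ₖ K i) := by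
        rw [← mul_kronecker_mul, Matrix.mul_one]
      rw [this, conjTranspose_mul]
      simp only [Matrix.mul_assoc]
    · rw [Fintype.sum_sigma]
      have h : ∀ i, ∑ s, ((X i s)ᴴ * X i s) ⊗ₖ ((Y i s * K i)ᴴ * (Y i s * K i))
          = (1 : Matrix (Fin a) (Fin a) ℂ) ⊗ₖ ((K i)ᴴ * K i) := by
        intro i
        have : ∀ s, ((X i s)ᴴ * X i s) ⊗ₖ ((Y i s * K i)ᴴ * (Y i s * K i))
            = ((1 : Matrix (Fin a) (Fin a) ℂ) ⊗ₖ (K i)ᴴ) *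
              (((X i s)ᴴ * X i s) ⊗ₖ ((Y i s)ᴴ * Y i s)) * ((1 : Matrix (Fin a) (Fin a) ℂ) ⊗ₖ K i) := by
          intro s
          rw [← mul_kronecker_mul, ← mul_kronecker_mul, conjTranspose_mul]
          simp only [Matrix.mul_assoc, Matrix.mul_one, Matrix.one_mul]
        simp only [this]
        rw [← Matrix.sum_mul, ← Matrix.mul_sum, hsum, Matrix.mul_one, ← mul_kronecker_mul,
          Matrix.mul_one]
      simp only [h]
      rw [← kronecker_sum, complete, one_kronecker_one]

theorem Protocol.run_zero {n a b : ℕ} (P : Protocol n a b) : P.run 0 = 0 := by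
  obtain ⟨ι, _, X, Y, h, -⟩ := P.exists_kraus
  simp [h]

/-- Only completeness of the Kraus operators enters; this is what makes the weight of a branch well
defined. -/
theorem Protocol.trace_run {n a b : ℕ} (P : Protocol n a b)
    (σ : Matrix (Fin a × Fin b) (Fin a × Fin b) ℂ) : (P.run σ).trace = σ.trace := by
  obtain ⟨ι, _, X, Y, h, h1⟩ := P.exists_kraus
  rw [h, trace_sum]
  have : ∀ s, ((X s ⊗ₖ Y s) * σ * (X s ⊗ₖ Y s)ᴴ).trace
      = ((((X s)ᴴ * X s) ⊗ₖ ((Y s)ᴴ * Y s)) * σ).trace := by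
    intro s
    rw [trace_mul_comm, ← Matrix.mul_assoc, conjTranspose_kronecker, ← mul_kronecker_mul]
  simp only [this]
  rw [← trace_sum, ← Finset.sum_mul, h1, Matrix.one_mul]

/-! ### Extremality of unitary channels -/

theorem isState_vecMulVec {κ : Type} [Fintype κ] [DecidableEq κ] (v : κ → ℂ)
    (hv : star v ⬝ᵥ v = 1) : IsState (vecMulVec v (star v)) := by
  refine ⟨posSemidef_vecMulVec_self_star v, ?_⟩
  rw [trace_vecMulVec, dotProduct_comm, hv]

/-- Test on the pure state of v and take the expectation in u ⟂ v: a sum of the squares |⟨u, L s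
v⟩|² vanishes, hence so does each term. -/
theorem kraus_dotProduct_eq_zero {κ ι : Type} [Fintype κ] [DecidableEq κ] [Fintype ι]
    (L : ι → Matrix κ κ ℂ) (w : ℂ)
    (h : ∀ ρ, IsState ρ → ∑ s, L s * ρ * (L s)ᴴ = w • ρ) (s : ι) (u v : κ → ℂ)
    (hv : star v ⬝ᵥ v = 1) (huv : star u ⬝ᵥ v = 0) : star u ⬝ᵥ (L s *ᵥ v) = 0 := by
  have h1 := h _ (isState_vecMulVec v hv)
  have h2 := congrArg (fun N => star u ⬝ᵥ (N *ᵥ u)) h1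
  have h3 : ∀ s, star u ⬝ᵥ ((L s * vecMulVec v (star v) * (L s)ᴴ) *ᵥ u)
      = star (star u ⬝ᵥ (L s *ᵥ v)) * (star u ⬝ᵥ (L s *ᵥ v)) := by
    intro s
    rw [Matrix.mul_vecMulVec, Matrix.vecMulVec_mul, Matrix.vecMulVec_mulVec, ← Matrix.star_mulVec]
    simp only [dotProduct_smul, MulOpposite.smul_eq_mul_unop, MulOpposite.unop_op]
    rw [mul_comm, ← star_dotProduct_star, star_star]
  simp only [Matrix.sum_mulVec, dotProduct_sum, h3, Matrix.smul_mulVec, Matrix.vecMulVec_mulVec,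
    dotProduct_smul, huv, smul_zero] at h2
  have h4 := (Finset.sum_eq_zero_iff_of_nonneg (fun s _ => star_mul_self_nonneg _)).1 h2 s
    (Finset.mem_univ s)
  simpa using h4

/-- Orthogonal basis vectors kill the off-diagonal entries; the orthogonal pair e_i − e_j, e_i + e_j
makes the diagonal entries equal. Only the second vector is normalized, since it serves as the input
state. -/
theorem exists_eq_smul_one_of_kraus {κ ι : Type} [Fintype κ] [DecidableEq κ] [Fintype ι]
    (L : ι → Matrix κ κ ℂ) (w : ℂ)
    (h : ∀ ρ, IsState ρ → ∑ s, L s * ρ * (L s)ᴴ = w • ρ) (s : ι) :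
    ∃ c : ℂ, L s = c • (1 : Matrix κ κ ℂ) := by
  have hoff : ∀ i j, i ≠ j → L s i j = 0 := by
    intro i j hij
    have := kraus_dotProduct_eq_zero L w h s (Pi.single i 1) (Pi.single j 1) (by simp)
      (by simp [hij])
    simpa using this
  have hdiag : ∀ i j, L s i i = L s j j := by
    intro i j
    by_cases hij : i = j
    · rw [hij]
    have hr : ((√2 : ℝ) : ℂ)⁻¹ * ((√2 : ℝ) : ℂ)⁻¹ = 1 / 2 := by
      rw [← mul_inv, ← Complex.ofReal_mul, Real.mul_self_sqrt (by norm_num)]; simp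
    have := kraus_dotProduct_eq_zero L w h s (Pi.single i 1 - Pi.single j 1)
      (((√2 : ℝ) : ℂ)⁻¹ • (Pi.single i 1 + Pi.single j 1))
      (by
        simp [star_add, dotProduct_add, hij, Ne.symm hij]
        linear_combination 2 * hr)
      (by simp [star_sub, dotProduct_add, hij, Ne.symm hij])
    simp [star_sub, sub_dotProduct, mulVec_smul, mulVec_add, hoff i j hij, hoff j i (Ne.symm hij)] at this
    linear_combination (2 * ((√2 : ℝ) : ℂ)⁻¹) * this - 2 * (L s i i - L s j j) * hr
  rcases isEmpty_or_nonempty κ with hκ | ⟨⟨i₀⟩⟩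
  · exact ⟨0, Subsingleton.elim _ _⟩
  · refine ⟨L s i₀ i₀, ?_⟩
    ext i j
    by_cases hij : i = j
    · subst hij; simp [hdiag i i₀]
    · simp [hoff i j hij, hij]

theorem exists_eq_smul_of_kraus {κ ι : Type} [Fintype κ] [DecidableEq κ] [Fintype ι]
    (L : ι → Matrix κ κ ℂ) (U : Matrix κ κ ℂ) (hU : Uᴴ * U = 1) (w : ℂ)
    (h : ∀ ρ, IsState ρ → ∑ s, L s * ρ * (L s)ᴴ = w • (U * ρ * Uᴴ)) :
    ∃ c : ι → ℂ, ∀ s, L s = c s • U := by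
  have h' : ∀ ρ, IsState ρ → ∑ s, (Uᴴ * L s) * ρ * (Uᴴ * L s)ᴴ = w • ρ := by
    intro ρ hρ
    have := congrArg (fun N => Uᴴ * N * U) (h ρ hρ)
    simp only [Finset.mul_sum, Finset.sum_mul, Matrix.mul_smul, Matrix.smul_mul] at this
    rw [show Uᴴ * (U * ρ * Uᴴ) * U = (Uᴴ * U) * ρ * (Uᴴ * U) by simp only [Matrix.mul_assoc], hU,
      Matrix.one_mul, Matrix.mul_one] at this
    rw [← this]
    refine Finset.sum_congr rfl fun s _ => ?_
    simp only [conjTranspose_mul, conjTranspose_conjTranspose, Matrix.mul_assoc]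
  choose c hc using exists_eq_smul_one_of_kraus _ w h'
  refine ⟨c, fun s => ?_⟩
  have hU' : U * Uᴴ = 1 := mul_eq_one_comm.1 hU
  calc L s = U * (Uᴴ * L s) := by rw [← Matrix.mul_assoc, hU', Matrix.one_mul]
    _ = c s • U := by rw [hc]; simp

/-! ### Protocols that realize a gate from an intermediate branch -/

/-- The protocol `P`, applied to the states `V ρ V†`, yields `w • U ρ U†`. -/
def Protocol.Realizes {n a b : ℕ} (P : Protocol n a b)
    (V : Matrix (Fin a × Fin b) (Fin 2 × Fin 2) ℂ)
    (U : Matrix (Fin 2 × Fin 2) (Fin 2 × Fin 2) ℂ) (w : ℝ) : Prop :=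
  ∀ ρ, IsState ρ → P.run (V * ρ * Vᴴ) = (w : ℂ) • (U * ρ * Uᴴ)

variable {n a b : ℕ} {V : Matrix (Fin a × Fin b) (Fin 2 × Fin 2) ℂ}
  {U : Matrix (Fin 2 × Fin 2) (Fin 2 × Fin 2) ℂ} {w : ℝ}

theorem sum_smul_conj {κ ι : Type} [Fintype κ] [Fintype ι] (c : ι → ℂ) (U ρ : Matrix κ κ ℂ) :
    ∑ s, (c s • U) * ρ * (c s • U)ᴴ = ((∑ s, ‖c s‖ ^ 2 : ℝ) : ℂ) • (U * ρ * Uᴴ) := by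
  rw [Complex.ofReal_sum, Finset.sum_smul]
  refine Finset.sum_congr rfl fun s _ => ?_
  rw [conjTranspose_smul, Matrix.smul_mul, Matrix.smul_mul, Matrix.mul_smul, smul_smul,
    Complex.ofReal_pow, ← Complex.mul_conj']
  rfl

theorem trace_conj_unitary {κ : Type} [Fintype κ] [DecidableEq κ] {U ρ : Matrix κ κ ℂ}
    (hU : Uᴴ * U = 1) (hρ : IsState ρ) : (U * ρ * Uᴴ).trace = 1 := by
  rw [trace_mul_comm, ← Matrix.mul_assoc, hU, Matrix.one_mul, hρ.2]

theorem exists_isState : ∃ ρ : Matrix (Fin 2 × Fin 2) (Fin 2 × Fin 2) ℂ, IsState ρ :=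
  ⟨_, isState_vecMulVec (Pi.single (0, 0) 1) (by simp)⟩

/-- All Kraus operators of a protocol realizing a unitary are proportional to it. -/
theorem Protocol.Realizes.exists_kraus {P : Protocol n a b} (h : P.Realizes V U w)
    (hU : Uᴴ * U = 1) :
    ∃ (ι : Type) (_ : Fintype ι) (X : ι → Matrix (Fin 2) (Fin a) ℂ)
      (Y : ι → Matrix (Fin 2) (Fin b) ℂ) (c : ι → ℂ),
      ∑ s, ((X s)ᴴ * X s) ⊗ₖ ((Y s)ᴴ * Y s) = 1 ∧ (∀ s, (X s ⊗ₖ Y s) * V = c s • U) ∧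
        ∑ s, ‖c s‖ ^ 2 = w := by
  obtain ⟨ι, hι, X, Y, hrun, hsum⟩ := Protocol.exists_kraus P
  have key : ∀ ρ, IsState ρ →
      ∑ s, ((X s ⊗ₖ Y s) * V) * ρ * ((X s ⊗ₖ Y s) * V)ᴴ = (w : ℂ) • (U * ρ * Uᴴ) := by
    intro ρ hρ
    rw [← h ρ hρ, hrun]
    refine Finset.sum_congr rfl fun s _ => ?_
    simp only [conjTranspose_mul, Matrix.mul_assoc]
  obtain ⟨c, hc⟩ := exists_eq_smul_of_kraus _ U hU _ key
  refine ⟨ι, hι, X, Y, c, hsum, hc, ?_⟩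
  obtain ⟨ρ, hρ⟩ := exists_isState
  have h1 := congrArg trace (key ρ hρ)
  simp only [hc] at h1
  rw [sum_smul_conj, trace_smul, trace_smul, trace_conj_unitary hU hρ] at h1
  simp only [smul_eq_mul, mul_one] at h1
  exact_mod_cast h1

/-- If a sum of completely positive maps in Kraus form realizes a unitary, so does each of them. -/
theorem exists_realizes_of_sum {r : ℕ} {n : ℕ} {da db : Fin r → ℕ}
    (next : ∀ i, Protocol n (da i) (db i))
    (W : ∀ i, Matrix (Fin (da i) × Fin (db i)) (Fin 2 × Fin 2) ℂ) (hU : Uᴴ * U = 1)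
    (h : ∀ ρ, IsState ρ → ∑ i, (next i).run (W i * ρ * (W i)ᴴ) = (w : ℂ) • (U * ρ * Uᴴ)) :
    ∃ v : Fin r → ℝ, ∑ i, v i = w ∧ ∀ i, (next i).Realizes (W i) U (v i) := by
  choose ι hι X Y hrun hsum using fun i => Protocol.exists_kraus (next i)
  have key0 : ∀ i ρ, (next i).run (W i * ρ * (W i)ᴴ) =
      ∑ s, ((X i s ⊗ₖ Y i s) * W i) * ρ * ((X i s ⊗ₖ Y i s) * W i)ᴴ := by
    intro i ρ
    rw [hrun]
    refine Finset.sum_congr rfl fun s _ => ?_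
    simp only [conjTranspose_mul, Matrix.mul_assoc]
  obtain ⟨c, hc⟩ := exists_eq_smul_of_kraus
    (fun s : Σ i, ι i => (X s.1 s.2 ⊗ₖ Y s.1 s.2) * W s.1) U hU w (by
      intro ρ hρ
      rw [← h ρ hρ, Fintype.sum_sigma]
      exact Finset.sum_congr rfl fun i _ => (key0 i ρ).symm)
  have hr : ∀ i, (next i).Realizes (W i) U (∑ s, ‖c ⟨i, s⟩‖ ^ 2) := by
    intro i ρ _
    rw [key0, ← sum_smul_conj]
    exact Finset.sum_congr rfl fun s _ => by rw [hc ⟨i, s⟩]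
  refine ⟨fun i => ∑ s, ‖c ⟨i, s⟩‖ ^ 2, ?_, hr⟩
  obtain ⟨ρ, hρ⟩ := exists_isState
  have h1 := congrArg trace (h ρ hρ)
  rw [trace_smul, trace_conj_unitary hU hρ, Finset.sum_congr rfl fun i _ => hr i ρ hρ,
    ← Finset.sum_smul, trace_smul, trace_conj_unitary hU hρ] at h1
  have h2 := h1
  simp only [smul_eq_mul, mul_one] at h2
  exact_mod_cast h2

theorem Protocol.Realizes.of_alice {r : ℕ} {d : Fin r → ℕ} {M : ∀ i, Matrix (Fin (d i)) (Fin a) ℂ}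
    {complete : ∑ i, (M i)ᴴ * M i = 1} {next : ∀ i, Protocol n (d i) b}
    (h : (Protocol.alice r d M complete next).Realizes V U w) (hU : Uᴴ * U = 1) :
    ∃ v : Fin r → ℝ, ∑ i, v i = w ∧
      ∀ i, (next i).Realizes ((M i ⊗ₖ (1 : Matrix (Fin b) (Fin b) ℂ)) * V) U (v i) := by
  refine exists_realizes_of_sum next _ hU fun ρ hρ => ?_
  rw [← h ρ hρ, Protocol.run]
  refine Finset.sum_congr rfl fun i _ => ?_
  simp only [conjTranspose_mul, Matrix.mul_assoc]

theorem Protocol.Realizes.of_bob {r : ℕ} {d : Fin r → ℕ} {K : ∀ i, Matrix (Fin (d i)) (Fin b) ℂ}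
    {complete : ∑ i, (K i)ᴴ * K i = 1} {next : ∀ i, Protocol n a (d i)}
    (h : (Protocol.bob r d K complete next).Realizes V U w) (hU : Uᴴ * U = 1) :
    ∃ v : Fin r → ℝ, ∑ i, v i = w ∧
      ∀ i, (next i).Realizes (((1 : Matrix (Fin a) (Fin a) ℂ) ⊗ₖ K i) * V) U (v i) := by
  refine exists_realizes_of_sum next _ hU fun ρ hρ => ?_
  rw [← h ρ hρ, Protocol.run]
  refine Finset.sum_congr rfl fun i _ => ?_
  simp only [conjTranspose_mul, Matrix.mul_assoc]

/-- Extremality is applied turn by turn along the outcome sequence, and the local operators collect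
into the accumulated ones. -/
theorem Protocol.Realizes.of_isNode {m a' b' : ℕ} {Q : Protocol m a' b'} {n a b : ℕ}
    {P : Protocol n a b} {A : Matrix (Fin a') (Fin a) ℂ} {B : Matrix (Fin b') (Fin b) ℂ}
    (hN : Q.IsNode P A B) (hU : Uᴴ * U = 1) :
    ∀ {V : Matrix (Fin a × Fin b) (Fin 2 × Fin 2) ℂ} {w : ℝ}, P.Realizes V U w →
      ∃ v, Q.Realizes ((A ⊗ₖ B) * V) U v := by
  induction hN with
  | here => intro V w h; exact ⟨w, by simpa using h⟩
  | alice i _ ih =>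
    intro V w h
    obtain ⟨v, -, hv⟩ := h.of_alice hU
    obtain ⟨v', h'⟩ := ih (hv i)
    refine ⟨v', ?_⟩
    rwa [← Matrix.mul_assoc, ← mul_kronecker_mul, Matrix.mul_one] at h'
  | bob i _ ih =>
    intro V w h
    obtain ⟨v, -, hv⟩ := h.of_bob hU
    obtain ⟨v', h'⟩ := ih (hv i)
    refine ⟨v', ?_⟩
    rwa [← Matrix.mul_assoc, ← mul_kronecker_mul, Matrix.mul_one] at h'

/-- Two protocols realizing the same unitary from the same branch do so with the same weight. -/
theorem Protocol.Realizes.weight_unique {n' : ℕ} {P : Protocol n a b} {P' : Protocol n' a b}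
    {w' : ℝ} (h : P.Realizes V U w) (h' : P'.Realizes V U w') (hU : Uᴴ * U = 1) : w = w' := by
  obtain ⟨ρ, hρ⟩ := exists_isState
  have h1 := congrArg trace (h ρ hρ)
  have h2 := congrArg trace (h' ρ hρ)
  rw [trace_smul, trace_conj_unitary hU hρ, Protocol.trace_run] at h1 h2
  rw [h1] at h2
  simpa using h2

/-- The last `m` turns of a protocol can be replaced branch by branch. -/
theorem exists_sameFirst {m m' : ℕ} (hU : Uᴴ * U = 1)
    (S : ∀ {a b : ℕ}, Matrix (Fin a × Fin b) (Fin 2 × Fin 2) ℂ → Prop)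
    (hS : ∀ {a b a' b' : ℕ} (X : Matrix (Fin a') (Fin a) ℂ) (Y : Matrix (Fin b') (Fin b) ℂ)
      (V : Matrix (Fin a × Fin b) (Fin 2 × Fin 2) ℂ), S V → S ((X ⊗ₖ Y) * V))
    (hrep : ∀ {a b : ℕ} (Q : Protocol m a b) (V : Matrix (Fin a × Fin b) (Fin 2 × Fin 2) ℂ)
      (w : ℝ), S V → Q.Realizes V U w → ∃ Q' : Protocol m' a b, Q'.Realizes V U w) (k : ℕ) :
    ∀ {a b : ℕ} (P : Protocol (m + k) a b) (V : Matrix (Fin a × Fin b) (Fin 2 × Fin 2) ℂ)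
      (w : ℝ), S V → P.Realizes V U w →
      ∃ P' : Protocol (m' + k) a b, P'.SameFirst k P ∧ P'.Realizes V U w := by
  induction k with
  | zero =>
    intro a b P V w hV h
    obtain ⟨Q', hQ'⟩ := hrep P V w hV h
    exact ⟨Q', .zero _ _, hQ'⟩
  | succ k ih =>
    intro a b P V w hV h
    cases P with
    | alice r d M complete next =>
      obtain ⟨v, hv, hn⟩ := h.of_alice hU
      choose next' hf hr using fun i => ih (next i) _ (v i) (hS _ _ _ hV) (hn i)
      refine ⟨.alice r d M complete next', .alice hf, fun ρ hρ => ?_⟩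
      rw [Protocol.run, ← hv, Complex.ofReal_sum, Finset.sum_smul]
      refine Finset.sum_congr rfl fun i _ => ?_
      rw [← hr i ρ hρ]
      simp only [conjTranspose_mul, Matrix.mul_assoc]
    | bob r d K complete next =>
      obtain ⟨v, hv, hn⟩ := h.of_bob hU
      choose next' hf hr using fun i => ih (next i) _ (v i) (hS _ _ _ hV) (hn i)
      refine ⟨.bob r d K complete next', .bob hf, fun ρ hρ => ?_⟩
      rw [Protocol.run, ← hv, Complex.ofReal_sum, Finset.sum_smul]
      refine Finset.sum_congr rfl fun i _ => ?_
      rw [← hr i ρ hρ]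
      simp only [conjTranspose_mul, Matrix.mul_assoc]

/-! ### Branch operators -/

/-- The operator from the two-qubit input to the current system of a branch, where `A i` and `B k`
are the local operators for the input basis states `i`, `k`. -/
def pairOp {a b : ℕ} (A : Fin 2 → Matrix (Fin a) (Fin 2) ℂ) (B : Fin 2 → Matrix (Fin b) (Fin 2) ℂ) :
    Matrix (Fin a × Fin b) (Fin 2 × Fin 2) ℂ :=
  Matrix.of fun x i => (A i.1 * (B i.2)ᵀ) x.1 x.2

theorem kronecker_mul_pairOp {a b a' b' : ℕ} (X : Matrix (Fin a') (Fin a) ℂ)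
    (Y : Matrix (Fin b') (Fin b) ℂ) (A : Fin 2 → Matrix (Fin a) (Fin 2) ℂ)
    (B : Fin 2 → Matrix (Fin b) (Fin 2) ℂ) :
    (X ⊗ₖ Y) * pairOp A B = pairOp (fun i => X * A i) (fun k => Y * B k) := by
  ext ⟨x, y⟩ ⟨i, k⟩
  have : (X * A i) * (Y * B k)ᵀ = X * (A i * (B k)ᵀ) * Yᵀ := by
    simp only [transpose_mul, Matrix.mul_assoc]
  simp only [pairOp, of_apply, this]
  rw [mul_apply, mul_apply, Fintype.sum_prod_type, Finset.sum_comm]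
  refine Finset.sum_congr rfl fun v _ => ?_
  rw [mul_apply, Finset.sum_mul]
  refine Finset.sum_congr rfl fun u _ => ?_
  simp only [kroneckerMap_apply, of_apply, transpose_apply]
  ring

/-- The operator `A (|i⟩ ⊗ E)`. -/
def inputBlock {a p : ℕ} (E : Matrix (Fin p) (Fin 2) ℂ) (A : Matrix (Fin a) (Fin (2 * p)) ℂ)
    (i : Fin 2) : Matrix (Fin a) (Fin 2) ℂ :=
  A.submatrix id (fun x => finProdFinEquiv (i, x)) * E

theorem inputBlock_mul {a a' p : ℕ} (E : Matrix (Fin p) (Fin 2) ℂ) (M : Matrix (Fin a') (Fin a) ℂ)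
    (A : Matrix (Fin a) (Fin (2 * p)) ℂ) (i : Fin 2) :
    inputBlock E (M * A) i = M * inputBlock E A i := by
  rw [inputBlock, inputBlock, ← Matrix.mul_assoc]
  rfl

/-- Here the resource is eliminated: whatever its local dimensions, a branch depends on it only
through the two columns of `E` and of `F`. -/
theorem branchState_eq {p q a b : ℕ} {ψ : EuclideanSpace ℂ (Fin p × Fin q)}
    {E : Matrix (Fin p) (Fin 2) ℂ} {F : Matrix (Fin q) (Fin 2) ℂ}
    (hψ : ∀ k l, ψ (k, l) = ∑ j, E k j * F l j)
    (A : Matrix (Fin a) (Fin (2 * p)) ℂ) (B : Matrix (Fin b) (Fin (2 * q)) ℂ)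
    (ρ : Matrix (Fin 2 × Fin 2) (Fin 2 × Fin 2) ℂ) :
    branchState ψ A B ρ = pairOp (inputBlock E A) (inputBlock F B) * ρ *
      (pairOp (inputBlock E A) (inputBlock F B))ᴴ := by
  have hJ : joint ρ ψ = pairOp (inputBlock E 1) (inputBlock F 1) * ρ *
      (pairOp (inputBlock E 1) (inputBlock F 1))ᴴ := by
    have hb : ∀ (x : Fin (2 * p)) (y : Fin (2 * q)) i k,
        pairOp (inputBlock E 1) (inputBlock F 1) (x, y) (i, k) =
          if (finProdFinEquiv.symm x).1 = i ∧ (finProdFinEquiv.symm y).1 = k then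
            ψ ((finProdFinEquiv.symm x).2, (finProdFinEquiv.symm y).2) else 0 := by
      intro x y i k
      obtain ⟨⟨x1, x2⟩, rfl⟩ := finProdFinEquiv.surjective x
      obtain ⟨⟨y1, y2⟩, rfl⟩ := finProdFinEquiv.surjective y
      have h1 : ∀ (p : ℕ) (E : Matrix (Fin p) (Fin 2) ℂ) (x1 : Fin 2) (x2 : Fin p) (i j : Fin 2),
          inputBlock E 1 i (finProdFinEquiv (x1, x2)) j = if x1 = i then E x2 j else 0 := by
        intro p E x1 x2 i j
        simp only [inputBlock, mul_apply, submatrix_apply, id_eq, one_apply,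
          EmbeddingLike.apply_eq_iff_eq, Prod.mk.injEq, ite_mul, one_mul, zero_mul]
        by_cases h : x1 = i <;> simp [h]
      simp only [pairOp, of_apply, mul_apply, transpose_apply, h1, Equiv.symm_apply_apply, hψ]
      by_cases h : x1 = i <;> by_cases h' : y1 = k <;> simp [h, h']
    ext ⟨x, y⟩ ⟨x', y'⟩
    simp only [mul_apply, conjTranspose_apply, Fintype.sum_prod_type, hb, joint]
    simp only [ite_and, ite_mul, zero_mul, mul_ite, mul_zero, apply_ite (star : ℂ → ℂ), star_zero]
    simp only [Finset.sum_ite_irrel, Finset.sum_const_zero, Finset.sum_ite_eq, Finset.mem_univ,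
      if_true]
    ring
  have hA : ∀ {p a : ℕ} (E : Matrix (Fin p) (Fin 2) ℂ) (A : Matrix (Fin a) (Fin (2 * p)) ℂ),
      inputBlock E A = fun i => A * inputBlock E (1 : Matrix (Fin (2 * p)) (Fin (2 * p)) ℂ) i := by
    intro p a E A
    funext i
    rw [← inputBlock_mul, Matrix.mul_one]
  rw [branchState, hJ, hA E A, hA F B, ← kronecker_mul_pairOp, conjTranspose_mul]
  simp only [Matrix.mul_assoc]

theorem gate_conjTranspose_mul_self (θ : ℝ) : (gate θ)ᴴ * gate θ = 1 := by
  rw [gate, diagonal_conjTranspose, diagonal_mul_diagonal, ← diagonal_one]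
  congr 1
  funext i
  by_cases h : i = (1, 1)
  · simp [h, ← Complex.exp_conj, ← Complex.exp_add]
  · simp [h]

/-! ### The relation between the local Gram matrices at a branch -/

/-- The Gram matrices of the local operators. -/
def gram {a : ℕ} (A : Fin 2 → Matrix (Fin a) (Fin 2) ℂ) (i i' : Fin 2) :
    Matrix (Fin 2) (Fin 2) ℂ := (A i)ᴴ * A i'

/-- The relation that holds between the Gram matrices of Alice and Bob at every branch from which
the gate with phase `e` is implemented with weight `w`. -/
structure Balanced (e : ℂ) (w : ℝ) (P Q : Fin 2 → Fin 2 → Matrix (Fin 2) (Fin 2) ℂ) : Prop where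
  offDiag : ∀ i i' k k', (i ≠ i' ∨ k ≠ k') → (P i i')ᵀ * Q k k' = 0
  trace : ∀ i k, ((P i i)ᵀ * Q k k).trace = w
  quad : e • ((P 0 0)ᵀ * Q 0 0 + (P 1 1)ᵀ * Q 1 1) - ((P 0 0)ᵀ * Q 1 1 + (P 1 1)ᵀ * Q 0 0) =
    ((w : ℂ) * (e - 1)) • (1 : Matrix (Fin 2) (Fin 2) ℂ)

/-- The transpose of PᵀQ is QᵀP and the phase table is symmetric, so results for one party transfer
to the other. -/
theorem Balanced.symm {e : ℂ} {w : ℝ} {P Q : Fin 2 → Fin 2 → Matrix (Fin 2) (Fin 2) ℂ}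
    (h : Balanced e w P Q) : Balanced e w Q P := by
  have ht : ∀ M N : Matrix (Fin 2) (Fin 2) ℂ, Nᵀ * M = (Mᵀ * N)ᵀ := by
    intro M N; rw [transpose_mul, transpose_transpose]
  refine ⟨fun i i' k k' hne => ?_, fun i k => ?_, ?_⟩
  · rw [ht, h.offDiag _ _ _ _ hne.symm, transpose_zero]
  · rw [ht, trace_transpose, h.trace]
  · have := congrArg transpose h.quad
    rw [transpose_smul, transpose_one] at this
    rw [← this, ht (P 0 0) (Q 0 0), ht (P 1 1) (Q 1 1), ht (P 0 0) (Q 1 1), ht (P 1 1) (Q 0 0)]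
    simp only [transpose_sub, transpose_smul, transpose_add]
    rw [add_comm (((P 1 1)ᵀ * Q 0 0)ᵀ)]

/-- The phases of the gate. -/
def phase (e : ℂ) (i k : Fin 2) : ℂ := if i = 1 ∧ k = 1 then e else 1

theorem gate_apply (θ : ℝ) (x y i k : Fin 2) :
    gate θ (x, y) (i, k) =
      if x = i ∧ y = k then phase (Complex.exp (θ * Complex.I)) i k else 0 := by
  rw [gate, diagonal_apply, phase]
  simp only [Prod.mk.injEq]
  by_cases h : x = i ∧ y = k
  · obtain ⟨rfl, rfl⟩ := h; simp
  · simp [h]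

/-- Each entry of the contracted product is a partial sum of entries of (A ⊗ B)ᴴ (R ⊗ T) (A' ⊗ B')
and thus linear in R ⊗ T, so completeness of the Kraus operators can be inserted. -/
theorem contract_kraus {a b : ℕ} {ι : Type} [Fintype ι] (X : ι → Matrix (Fin 2) (Fin a) ℂ)
    (Y : ι → Matrix (Fin 2) (Fin b) ℂ)
    (hsum : ∑ s, ((X s)ᴴ * X s) ⊗ₖ ((Y s)ᴴ * Y s) = 1)
    (A A' : Matrix (Fin a) (Fin 2) ℂ) (B B' : Matrix (Fin b) (Fin 2) ℂ) :
    ∑ s, ((X s * A)ᴴ * (X s * A'))ᵀ * ((Y s * B)ᴴ * (Y s * B')) = (Aᴴ * A')ᵀ * (Bᴴ * B') := by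
  ext j l
  have key : ∀ (R : Matrix (Fin a) (Fin a) ℂ) (T : Matrix (Fin b) (Fin b) ℂ),
      ((Aᴴ * R * A')ᵀ * (Bᴴ * T * B')) j l =
        ∑ m, ((A ⊗ₖ B)ᴴ * (R ⊗ₖ T) * (A' ⊗ₖ B')) (m, m) (j, l) := by
    intro R T
    rw [conjTranspose_kronecker, ← mul_kronecker_mul, ← mul_kronecker_mul]
    simp only [kroneckerMap_apply]
    rw [mul_apply]
    rfl
  have h1 : ∀ s, ((X s * A)ᴴ * (X s * A'))ᵀ * ((Y s * B)ᴴ * (Y s * B'))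
      = (Aᴴ * ((X s)ᴴ * X s) * A')ᵀ * (Bᴴ * ((Y s)ᴴ * Y s) * B') := by
    intro s; simp only [conjTranspose_mul, Matrix.mul_assoc]
  have h2 : (Aᴴ * A')ᵀ * (Bᴴ * B') =
      (Aᴴ * (1 : Matrix (Fin a) (Fin a) ℂ) * A')ᵀ * (Bᴴ * (1 : Matrix (Fin b) (Fin b) ℂ) * B') := by
    simp only [Matrix.mul_one]
  simp only [h1]
  rw [h2, Matrix.sum_apply]
  simp only [key]
  rw [Finset.sum_comm]
  refine Finset.sum_congr rfl fun m _ => ?_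
  rw [one_kronecker_one, ← hsum, Matrix.mul_sum, Matrix.sum_mul, Matrix.sum_apply]

theorem eq_zero_of_dotProduct_basis {β : Matrix (Fin 2) (Fin 2) ℂ} (hβ : β.det ≠ 0)
    (v : Fin 2 → ℂ) (h : ∀ k, v ⬝ᵥ β k = 0) : v = 0 := by
  have : β *ᵥ v = 0 := by
    funext k
    rw [mulVec, dotProduct_comm]
    exact h k
  exact eq_zero_of_mulVec_eq_zero hβ this

theorem star_mul_self_of_norm_eq_one {e : ℂ} (h : ‖e‖ = 1) : star e * e = 1 := by
  have := Complex.conj_mul' e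
  rw [h] at this
  simpa using this

/-- The relation at the end of a branch that yields a multiple of the gate. -/
theorem balanced_of_leaf {e c : ℂ} (he : e ≠ 1) (he1 : ‖e‖ = 1)
    (A B : Fin 2 → Matrix (Fin 2) (Fin 2) ℂ)
    (h : ∀ x y i k, (A i * (B k)ᵀ) x y = if x = i ∧ y = k then c * phase e i k else 0) :
    Balanced e (‖c‖ ^ 2) (gram A) (gram B) := by
  have hD : ∀ i i' k k' j l, ((gram A i i')ᵀ * gram B k k') j l =
      star (c * phase e i k) * (A i' i j * B k' k l) := by
    intro i i' k k' j l
    have h1 : ((gram A i i')ᵀ * gram B k k') j l =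
        ∑ x, ∑ y, star ((A i * (B k)ᵀ) x y) * (A i' x j * B k' y l) := by
      simp only [gram, mul_apply, transpose_apply, conjTranspose_apply, Fin.sum_univ_two, star_add,
        star_mul']
      ring
    simp only [h1, h, ite_and, apply_ite (star : ℂ → ℂ), star_zero, ite_mul, zero_mul]
    simp
  have hee := star_mul_self_of_norm_eq_one he1
  have hphase : ∀ i k, star (phase e i k) * phase e i k = 1 := by
    intro i k
    unfold phase
    split_ifs
    · exact hee
    · simp
  have hcc : star c * c = ((‖c‖ ^ 2 : ℝ) : ℂ) := by
    rw [Complex.ofReal_pow, ← Complex.conj_mul']; rfl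
  by_cases hc : c = 0
  · subst hc
    have hD0 : ∀ i i' k k', (gram A i i')ᵀ * gram B k k' = 0 := by
      intro i i' k k'
      ext j l
      simp [hD]
    exact ⟨fun i i' k k' _ => hD0 _ _ _ _, fun i k => by simp [hD0], by simp [hD0]⟩
  let α : Matrix (Fin 2) (Fin 2) ℂ := of fun i j => A i i j
  let β : Matrix (Fin 2) (Fin 2) ℂ := of fun k j => B k k j
  -- Up to the factor e − 1, `G` is the inverse of the phase table (1, 1; 1, e), while α βᵀ is c
  -- times that table.
  let G : Matrix (Fin 2) (Fin 2) ℂ := !![e, -1; -1, 1]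
  have hαβ : ∀ i k, A i i 0 * B k k 0 + A i i 1 * B k k 1 = c * phase e i k := by
    intro i k
    have := h i k i k
    simpa [mul_apply, Fin.sum_univ_two] using this
  have h00 := hαβ 0 0
  have h01 := hαβ 0 1
  have h10 := hαβ 1 0
  have h11 := hαβ 1 1
  simp [phase] at h00 h01 h10 h11
  have hk : c * (e - 1) ≠ 0 := mul_ne_zero hc (sub_ne_zero.2 he)
  have hmul : α * (βᵀ * G) = (c * (e - 1)) • (1 : Matrix (Fin 2) (Fin 2) ℂ) := by
    ext i j
    fin_cases i <;> fin_cases j <;>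
      simp [α, β, G, mul_apply, Fin.sum_univ_two]
    · linear_combination e * h00 - h01
    · linear_combination h01 - h00
    · linear_combination e * h10 - h11
    · linear_combination h11 - h10
  have hmul' : (βᵀ * G) * α = (c * (e - 1)) • (1 : Matrix (Fin 2) (Fin 2) ℂ) := by
    have h1 : ((c * (e - 1))⁻¹ • α) * (βᵀ * G) = 1 := by
      rw [Matrix.smul_mul, hmul, smul_smul, inv_mul_cancel₀ hk, one_smul]
    have h2 := mul_eq_one_comm.1 h1
    rw [Matrix.mul_smul] at h2
    rw [← h2, smul_smul, mul_inv_cancel₀ hk, one_smul]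
  have hdet : α.det ≠ 0 ∧ β.det ≠ 0 := by
    have := congrArg det hmul
    rw [det_mul, det_mul, det_transpose, det_smul, det_one, mul_one] at this
    have h0 : (c * (e - 1)) ^ Fintype.card (Fin 2) ≠ 0 := pow_ne_zero _ hk
    rw [← this] at h0
    constructor
    · intro h; simp [h] at h0
    · intro h; simp [h] at h0
  -- Row i of `A i'` is orthogonal (bilinearly) to the rows of the invertible β, so it vanishes.
  have hA0 : ∀ i i', i ≠ i' → A i' i = 0 := by
    intro i i' hi
    refine eq_zero_of_dotProduct_basis hdet.2 _ fun k => ?_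
    have := h i k i' k
    rw [if_neg (fun h => hi h.1)] at this
    simpa [mul_apply, dotProduct, β] using this
  have hB0 : ∀ k k', k ≠ k' → B k' k = 0 := by
    intro k k' hk
    refine eq_zero_of_dotProduct_basis hdet.1 _ fun i => ?_
    have := h i k i k'
    rw [if_neg (fun h => hk h.2)] at this
    simpa [mul_apply, dotProduct, α, mul_comm] using this
  refine ⟨fun i i' k k' hne => ?_, fun i k => ?_, ?_⟩
  · ext j l
    rw [hD]
    rcases hne with hi | hk
    · simp [hA0 i i' hi]
    · simp [hB0 k k' hk]
  · rw [Matrix.trace, ← hcc]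
    simp only [diag_apply, hD, Fin.sum_univ_two]
    rw [star_mul']
    linear_combination star c * star (phase e i k) * hαβ i k + star c * c * hphase i k
  · ext j l
    have h1 := congrFun (congrFun hmul' l) j
    simp only [mul_apply, Fin.sum_univ_two, transpose_apply, of_apply, α, β, G, Matrix.smul_apply,
      cons_val_zero, cons_val_one, cons_val', smul_eq_mul, cons_val_fin_one] at h1
    simp only [Matrix.sub_apply, Matrix.smul_apply, Matrix.add_apply, hD, smul_eq_mul]
    rw [← hcc, ← (show (1 : Matrix (Fin 2) (Fin 2) ℂ) l j = (1 : Matrix (Fin 2) (Fin 2) ℂ) j l by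
      simp [one_apply, eq_comm])]
    simp [phase]
    simp only [starRingEnd_apply]
    linear_combination star c * h1 + star c * A 1 1 j * B 1 1 l * hee

/-- Every Kraus branch ends in a multiple of the gate, where `balanced_of_leaf` applies; all three
relations are linear in PᵀQ and the weight, so they can be summed over the leaves. -/
theorem Protocol.Realizes.balanced {n a b : ℕ} {P : Protocol n a b} {θ w : ℝ}
    {A : Fin 2 → Matrix (Fin a) (Fin 2) ℂ} {B : Fin 2 → Matrix (Fin b) (Fin 2) ℂ}
    (h : P.Realizes (pairOp A B) (gate θ) w) (hθ : Complex.exp (θ * Complex.I) ≠ 1) :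
    Balanced (Complex.exp (θ * Complex.I)) w (gram A) (gram B) := by
  obtain ⟨ι, _, X, Y, c, hsum, hc, hw⟩ := h.exists_kraus (gate_conjTranspose_mul_self θ)
  have hleaf : ∀ s, Balanced (Complex.exp (θ * Complex.I)) (‖c s‖ ^ 2)
      (gram fun i => X s * A i) (gram fun k => Y s * B k) := by
    intro s
    refine balanced_of_leaf hθ (Complex.norm_exp_ofReal_mul_I θ) _ _ fun x y i k => ?_
    have := congrFun (congrFun (hc s) (x, y)) (i, k)
    rw [kronecker_mul_pairOp, Matrix.smul_apply, gate_apply, smul_eq_mul, mul_ite, mul_zero] at this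
    exact this
  have hD : ∀ i i' k k', (gram A i i')ᵀ * gram B k k' =
      ∑ s, (gram (fun i => X s * A i) i i')ᵀ * gram (fun k => Y s * B k) k k' :=
    fun i i' k k' => (contract_kraus X Y hsum _ _ _ _).symm
  refine ⟨fun i i' k k' hne => ?_, fun i k => ?_, ?_⟩
  · rw [hD]
    exact Finset.sum_eq_zero fun s _ => (hleaf s).offDiag i i' k k' hne
  · rw [hD, trace_sum, ← hw, Complex.ofReal_sum]
    exact Finset.sum_congr rfl fun s _ => (hleaf s).trace i k
  · simp only [hD]
    rw [← hw, Complex.ofReal_sum, Finset.sum_mul, Finset.sum_smul, ← Finset.sum_add_distrib,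
      ← Finset.sum_add_distrib, Finset.smul_sum, ← Finset.sum_sub_distrib]
    exact Finset.sum_congr rfl fun s _ => (hleaf s).quad

/-! ### Consequences of the relation -/

theorem star_dotProduct_gram {a : ℕ} (A A' : Matrix (Fin a) (Fin 2) ℂ) (z z' : Fin 2 → ℂ) :
    star z ⬝ᵥ ((Aᴴ * A') *ᵥ z') = star (A *ᵥ z) ⬝ᵥ (A' *ᵥ z') := by
  rw [star_mulVec, ← mulVec_mulVec, dotProduct_mulVec]

theorem star_dotProduct_gram_nonneg {a : ℕ} (A : Matrix (Fin a) (Fin 2) ℂ) (z : Fin 2 → ℂ) :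
    0 ≤ star z ⬝ᵥ ((Aᴴ * A) *ᵥ z) := by
  rw [star_dotProduct_gram]
  exact dotProduct_star_self_nonneg _

theorem gram_mulVec_eq_zero {a : ℕ} {A : Matrix (Fin a) (Fin 2) ℂ} {z : Fin 2 → ℂ}
    (h : star z ⬝ᵥ ((Aᴴ * A) *ᵥ z) = 0) : (Aᴴ * A) *ᵥ z = 0 := by
  rw [star_dotProduct_gram] at h
  rw [← mulVec_mulVec, dotProduct_star_self_eq_zero.1 h, mulVec_zero]

theorem eq_zero_of_mul_eq_zero_right {M S : Matrix (Fin 2) (Fin 2) ℂ} (hS : S.det ≠ 0)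
    (h : M * S = 0) : M = 0 := by
  rw [← mul_nonsing_inv_cancel_right S M (isUnit_iff_ne_zero.2 hS), h, Matrix.zero_mul]

theorem eq_zero_of_mul_eq_zero_left {M S : Matrix (Fin 2) (Fin 2) ℂ} (hS : S.det ≠ 0)
    (h : S * M = 0) : M = 0 := by
  rw [← nonsing_inv_mul_cancel_left S M (isUnit_iff_ne_zero.2 hS), h, Matrix.mul_zero]

variable {e : ℂ} {w : ℝ} {P Q : Fin 2 → Fin 2 → Matrix (Fin 2) (Fin 2) ℂ}

theorem Balanced.eq_zero_of_mulVec (h : Balanced e w P Q) (he : e ≠ 1) (hw : w ≠ 0)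
    {z : Fin 2 → ℂ} (h0 : Q 0 0 *ᵥ z = 0) (h1 : Q 1 1 *ᵥ z = 0) : z = 0 := by
  have := congrArg (fun N => N *ᵥ z) h.quad
  simp only [sub_mulVec, smul_mulVec, add_mulVec, ← mulVec_mulVec, h0, h1, mulVec_zero, add_zero,
    smul_zero, sub_zero, one_mulVec] at this
  refine (smul_eq_zero.1 this.symm).resolve_left ?_
  exact mul_ne_zero (by exact_mod_cast hw) (sub_ne_zero.2 he)

/-- On a kernel vector z the nonnegative values x, y of the forms for k = 0, 1 satisfy e y = x. As
|e| = 1 they agree, and as e ≠ 1 they vanish; then z is in both kernels, which the quadratic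
relation excludes. -/
theorem Balanced.det_ne_zero {b : ℕ} {B : Fin 2 → Matrix (Fin b) (Fin 2) ℂ}
    (h : Balanced e w P (gram B)) (he : e ≠ 1) (he1 : ‖e‖ = 1) (hw : w ≠ 0) :
    (e • gram B 1 1 - gram B 0 0).det ≠ 0 := by
  intro hdet
  obtain ⟨z, hz, hz0⟩ := exists_mulVec_eq_zero_iff.2 hdet
  apply hz
  rw [sub_mulVec, smul_mulVec, sub_eq_zero] at hz0
  have h1 := congrArg (fun v => star z ⬝ᵥ v) hz0
  simp only [dotProduct_smul, smul_eq_mul] at h1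
  have n0 := star_dotProduct_gram_nonneg (B 0) z
  have n1 := star_dotProduct_gram_nonneg (B 1) z
  rw [gram, gram] at h1
  set x := star z ⬝ᵥ (((B 0)ᴴ * B 0) *ᵥ z)
  set y := star z ⬝ᵥ (((B 1)ᴴ * B 1) *ᵥ z)
  have hxy : y = x := by
    have h2 := congrArg norm h1
    rw [norm_mul, he1, one_mul] at h2
    rw [← Complex.norm_of_nonneg' n0, ← Complex.norm_of_nonneg' n1, h2]
  have hx : x = 0 := by
    rw [hxy] at h1
    have : (e - 1) * x = 0 := by linear_combination h1
    exact (mul_eq_zero.1 this).resolve_left (sub_ne_zero.2 he)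
  exact h.eq_zero_of_mulVec he hw (gram_mulVec_eq_zero hx) (gram_mulVec_eq_zero (hxy.trans hx))

theorem exists_eq_vecMulVec_of_rank_eq_one {b : ℕ} {B : Matrix (Fin b) (Fin 2) ℂ}
    (h : B.rank = 1) : ∃ u v, B = vecMulVec u v := by
  obtain ⟨⟨u, hu⟩, -, hall⟩ := finrank_eq_one_iff'.1 h
  choose c hc using fun j : Fin 2 =>
    hall ⟨B.mulVecLin (Pi.single j 1), LinearMap.mem_range_self _ _⟩
  refine ⟨u, c, ?_⟩
  ext i j
  have := congrFun (congrArg Subtype.val (hc j)) i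
  simp at this
  rw [vecMulVec_apply, ← this, mul_comm]

/-- If one of the Gram matrices has rank one, a further local operator only rescales them. -/
theorem Balanced.gram_mul_eq {a b b' : ℕ} {A : Fin 2 → Matrix (Fin a) (Fin 2) ℂ}
    {B : Fin 2 → Matrix (Fin b) (Fin 2) ℂ} {K : Matrix (Fin b') (Fin b) ℂ} {w' : ℝ}
    (h : Balanced e w (gram A) (gram B))
    (h' : Balanced e w' (gram A) (gram fun k => K * B k))
    (he : e ≠ 1) (he1 : ‖e‖ = 1) (hw : w ≠ 0) (hr : (B 0).rank = 1) (k k' : Fin 2) :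
    gram (fun k => K * B k) k k' = ((w' / w : ℝ) : ℂ) • gram B k k' := by
  have hwc : (w : ℂ) ≠ 0 := by exact_mod_cast hw
  have hdet : (e • (gram A 1 1)ᵀ - (gram A 0 0)ᵀ).det ≠ 0 := by
    rw [← transpose_smul, ← transpose_sub, det_transpose]
    exact h.symm.det_ne_zero he he1 hw
  -- Both diagonal blocks of Alice annihilate N, hence so does their invertible combination from
  -- `hdet`.
  have hzero : ∀ N : Matrix (Fin 2) (Fin 2) ℂ, (∀ i, (gram A i i)ᵀ * N = 0) → N = 0 := by
    intro N hN
    refine eq_zero_of_mul_eq_zero_left hdet ?_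
    rw [Matrix.sub_mul, Matrix.smul_mul, hN, hN]
    simp
  have hoff : ∀ {k k' : Fin 2}, k ≠ k' →
      gram (fun k => K * B k) k k' = ((w' / w : ℝ) : ℂ) • gram B k k' := by
    intro k k' hk
    rw [hzero _ fun i => h.offDiag i i k k' (Or.inr hk),
      hzero _ fun i => h'.offDiag i i k k' (Or.inr hk), smul_zero]
  obtain ⟨u, v, huv⟩ := exists_eq_vecMulVec_of_rank_eq_one hr
  -- Before and after `K` the block is a multiple of the same rank-one matrix, so the trace
  -- relations determine the ratio.
  have h00 : gram (fun k => K * B k) 0 0 = ((w' / w : ℝ) : ℂ) • gram B 0 0 := by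
    have g0 : gram B 0 0 = (star u ⬝ᵥ u) • vecMulVec (star v) v := by
      ext i j
      simp only [gram, huv, mul_apply, conjTranspose_apply, vecMulVec_apply, Matrix.smul_apply,
        dotProduct, Finset.sum_mul, smul_eq_mul, Pi.star_apply, star_mul']
      exact Finset.sum_congr rfl fun x _ => by ring
    have g1 : gram (fun k => K * B k) 0 0 = (star (K *ᵥ u) ⬝ᵥ (K *ᵥ u)) • vecMulVec (star v) v := by
      ext i j
      simp only [gram, huv, mul_vecMulVec, mul_apply, conjTranspose_apply, vecMulVec_apply,
        Matrix.smul_apply, dotProduct, Finset.sum_mul, smul_eq_mul, Pi.star_apply, star_mul']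
      exact Finset.sum_congr rfl fun x _ => by ring
    have t0 := h.trace 0 0
    have t1 := h'.trace 0 0
    rw [g0, Matrix.mul_smul, trace_smul, smul_eq_mul] at t0
    rw [g1, Matrix.mul_smul, trace_smul, smul_eq_mul] at t1
    set τ := ((gram A 0 0)ᵀ * vecMulVec (star v) v).trace
    have hτ : τ ≠ 0 := by rintro h; rw [h, mul_zero] at t0; exact hwc t0.symm
    rw [g0, g1, smul_smul]
    congr 1
    rw [Complex.ofReal_div, ← t0, ← t1]
    have : star u ⬝ᵥ u ≠ 0 := by rintro h; rw [h, zero_mul] at t0; exact hwc t0.symm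
    field_simp
  -- With the (0,0) block known, the quadratic relation is a linear equation for the (1,1) block
  -- with the invertible coefficient from `hdet`.
  have h11 : gram (fun k => K * B k) 1 1 = ((w' / w : ℝ) : ℂ) • gram B 1 1 := by
    rw [← sub_eq_zero]
    refine eq_zero_of_mul_eq_zero_left hdet ?_
    have q := h.quad
    have q' := h'.quad
    rw [h00] at q'
    have hl : ((w' : ℝ) : ℂ) = ((w' / w : ℝ) : ℂ) * w := by
      rw [Complex.ofReal_div]; field_simp
    rw [hl, mul_assoc, mul_smul, ← q] at q'
    generalize ((w' / w : ℝ) : ℂ) = l at q' ⊢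
    rw [← sub_eq_zero] at q'
    rw [← q']
    simp only [Matrix.mul_smul, Matrix.mul_sub, Matrix.sub_mul, Matrix.smul_mul]
    module
  fin_cases k <;> fin_cases k'
  · exact h00
  · exact hoff (by decide)
  · exact hoff (by decide)
  · exact h11

/-- Take the trace of the quadratic relation against X = rᵀ adj(pᵀ), where p, r are the two diagonal
blocks of P. Here X pᵀ = det(p) rᵀ, and Cayley–Hamilton gives X rᵀ = tr(X) rᵀ − det(r) pᵀ. Since the
four traces are all w, the terms with tr(X) cancel and w (e − 1)(det p − det r) = 0 remains. -/
theorem Balanced.det_eq (h : Balanced e w P Q) (he : e ≠ 1) (hw : w ≠ 0) :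
    (P 0 0).det = (P 1 1).det := by
  have hwc : (w : ℂ) ≠ 0 := by exact_mod_cast hw
  have t := h.trace
  have q := h.quad
  have t00 := t 0 0
  have t01 := t 0 1
  have t10 := t 1 0
  have t11 := t 1 1
  have q00 := congrFun (congrFun q 0) 0
  have q01 := congrFun (congrFun q 0) 1
  have q10 := congrFun (congrFun q 1) 0
  have q11 := congrFun (congrFun q 1) 1
  generalize P 0 0 = p at *
  generalize P 1 1 = r at *
  generalize Q 0 0 = s at *
  generalize Q 1 1 = u at *
  simp only [trace_fin_two, mul_apply, Fin.sum_univ_two, transpose_apply, Matrix.sub_apply,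
    Matrix.add_apply, Matrix.smul_apply, smul_eq_mul, one_apply_eq, mul_one,
    one_apply_ne (show (0 : Fin 2) ≠ 1 by decide), one_apply_ne (show (1 : Fin 2) ≠ 0 by decide),
    mul_zero] at t00 t01 t10 t11 q00 q01 q10 q11
  rw [det_fin_two, det_fin_two]
  set m := p 1 1 * r 0 0 - p 0 1 * r 1 0 - p 1 0 * r 0 1 + p 0 0 * r 1 1 with hm
  set dp := p 0 0 * p 1 1 - p 0 1 * p 1 0 with hdp
  set dr := r 0 0 * r 1 1 - r 0 1 * r 1 0 with hdr
  have key : ((w : ℂ) * (e - 1)) * (dp - dr) = 0 := by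
    linear_combination
      (r 0 0 * p 1 1 - r 1 0 * p 0 1) * q00 + (-r 0 0 * p 1 0 + r 1 0 * p 0 0) * q10
      + (r 0 1 * p 1 1 - r 1 1 * p 0 1) * q01 + (-r 0 1 * p 1 0 + r 1 1 * p 0 0) * q11
      - e * (dp * t10 + m * t11 - dr * t01) + (dp * t11 + m * t10 - dr * t00)
  have := (mul_eq_zero.1 key).resolve_left (mul_ne_zero hwc (sub_ne_zero.2 he))
  linear_combination this

/-! ### Splitting the Gram matrices into rank-one parts -/

theorem exists_unit_mul_eq_norm (z : ℂ) : ∃ u : ℂ, ‖u‖ = 1 ∧ z = ‖z‖ * u := by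
  by_cases hz : z = 0
  · exact ⟨1, by simp, by simp [hz]⟩
  · have h : (‖z‖ : ℂ) ≠ 0 := by simpa using hz
    exact ⟨z / ‖z‖, by simp [hz], by field_simp⟩

/-- A positive semidefinite `2 × 2` matrix with vanishing expectation `∑ P i j * H i j` is a sum of
two rank-one parts with vanishing expectation. -/
theorem exists_neutral_split {a : ℕ} (A : Matrix (Fin a) (Fin 2) ℂ)
    {H : Matrix (Fin 2) (Fin 2) ℂ} (hH : H.IsHermitian) (htr : ((Aᴴ * A)ᵀ * H).trace = 0) :
    ∃ α : Fin 2 → Fin 2 → ℂ, Aᴴ * A = ∑ j, vecMulVec (star (α j)) (α j) ∧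
      ∀ j, star (α j) ⬝ᵥ (H *ᵥ α j) = 0 := by
  obtain ⟨S, hS⟩ : ∃ S : Matrix (Fin 2) (Fin 2) ℂ, Aᴴ * A = Sᴴ * S :=
    CStarAlgebra.nonneg_iff_eq_star_mul_self.1 (posSemidef_conjTranspose_mul_self A).nonneg
  let f : Fin 2 → Fin 2 → ℂ := fun i i' => star (S i) ⬝ᵥ (H *ᵥ S i')
  have hf : ∀ i i', star (f i i') = f i' i := by
    intro i i'
    have h00 := hH.apply 0 0
    have h01 := hH.apply 0 1
    have h10 := hH.apply 1 0
    have h11 := hH.apply 1 1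
    simp only [f, dotProduct, mulVec, Fin.sum_univ_two, Pi.star_apply, star_add, star_mul',
      star_star, h00, h01, h10, h11]
    ring
  have hdiag : f 0 0 + f 1 1 = 0 := by
    rw [hS] at htr
    rw [← htr]
    simp only [f, dotProduct, mulVec, Fin.sum_univ_two, Pi.star_apply, trace_fin_two, mul_apply,
      transpose_apply, conjTranspose_apply]
    ring
  -- The parts will be (S 0 ± i u S 1)/√2 with u the phase of f 1 0: the cross terms become purely
  -- imaginary multiples that cancel, and the diagonal terms give f 0 0 + f 1 1 = 0.
  obtain ⟨u, hu, hz⟩ := exists_unit_mul_eq_norm (f 1 0)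
  have huu := star_mul_self_of_norm_eq_one hu
  have hr : ((√2 : ℝ) : ℂ)⁻¹ * ((√2 : ℝ) : ℂ)⁻¹ = 1 / 2 := by
    rw [← mul_inv, ← Complex.ofReal_mul, Real.mul_self_sqrt (by norm_num)]; simp
  have hz' : f 0 1 = ‖f 1 0‖ * star u := by
    rw [← hf 1 0]
    conv_lhs => rw [hz]
    simp
  generalize hR : ‖f 1 0‖ = R at hz hz'
  have hv : ∀ t : ℂ,
      star (((√2 : ℝ) : ℂ)⁻¹ • (S 0 + (t * u) • S 1)) ⬝ᵥ
        (H *ᵥ (((√2 : ℝ) : ℂ)⁻¹ • (S 0 + (t * u) • S 1))) =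
      (1 / 2) * (f 0 0 + star (t * u) * (t * u) * f 1 1 + (t * u) * f 0 1 + star (t * u) * f 1 0) := by
    intro t
    have hsr : star (((√2 : ℝ) : ℂ)⁻¹) = ((√2 : ℝ) : ℂ)⁻¹ := by simp
    rw [← hr]
    simp only [mulVec_smul, mulVec_add, star_smul, star_add, dotProduct_smul, smul_dotProduct,
      add_dotProduct, dotProduct_add, smul_eq_mul, hsr, f]
    ring
  let t : Fin 2 → ℂ := ![Complex.I, -Complex.I]
  have ht : ∀ j, star (t j) = -t j := by
    intro j; fin_cases j <;> simp [t]
  have ht2 : ∀ j, t j * t j = -1 := by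
    intro j; fin_cases j <;> simp [t]
  refine ⟨fun j => ((√2 : ℝ) : ℂ)⁻¹ • (S 0 + (t j * u) • S 1), ?_, fun j => ?_⟩
  · rw [hS]
    ext x y
    simp only [Fin.sum_univ_two, Matrix.add_apply, vecMulVec_apply, mul_apply, conjTranspose_apply,
      Pi.star_apply, Pi.smul_apply, Pi.add_apply, smul_eq_mul, star_mul', star_add, ht]
    have hsr : star (((√2 : ℝ) : ℂ)⁻¹) = ((√2 : ℝ) : ℂ)⁻¹ := by simp
    rw [hsr]
    have e0 := ht2 0
    have t1 : t 1 = - t 0 := by simp [t]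
    rw [t1]
    generalize ((√2 : ℝ) : ℂ)⁻¹ = r at hr ⊢
    generalize t 0 = i at e0
    linear_combination (-2 * star (S 0 x) * S 0 y - 2 * star (S 1 x) * S 1 y) * hr
      + 2 * r * r * star u * u * star (S 1 x) * S 1 y * e0
      - 2 * r * r * star (S 1 x) * S 1 y * huu
  · rw [hv, star_mul', ht, hz, hz']
    linear_combination (1 / 2 : ℂ) * hdiag + (1 / 2 : ℂ) * (-(star u * u) * f 1 1) * ht2 j
      + (1 / 2 : ℂ) * f 1 1 * huu

/-- Completing a vector on which the two forms agree to a pair adapted to the gate. -/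
theorem partner_form {e : ℂ} (he1 : ‖e‖ = 1) {Q₀ Q₁ : Matrix (Fin 2) (Fin 2) ℂ}
    (h₀ : Q₀.IsHermitian) (h₁ : Q₁.IsHermitian) (hdet : Q₀.det = Q₁.det) (α v α' : Fin 2 → ℂ) {W : ℂ}
    (hW0 : star α ⬝ᵥ (Q₀ *ᵥ α) = W) (hW1 : star α ⬝ᵥ (Q₁ *ᵥ α) = W)
    (hv : v = (Q₁ - star e • Q₀) *ᵥ α) (hα' : α' = ![star (v 1), -star (v 0)]) :
    star α' ⬝ᵥ (Q₀ *ᵥ α') = ((Q₀.adjugate * Q₁).trace - (e + star e) * Q₀.det) * W ∧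
    star α' ⬝ᵥ (Q₁ *ᵥ α') = ((Q₀.adjugate * Q₁).trace - (e + star e) * Q₀.det) * W ∧
    star α ⬝ᵥ (Q₁ *ᵥ α') = e * (star α ⬝ᵥ (Q₀ *ᵥ α')) ∧
    α 0 * α' 1 - α 1 * α' 0 = (e - 1) * star W := by
  have hee := star_mul_self_of_norm_eq_one he1
  have a00 := h₀.apply 0 0
  have a01 := h₀.apply 0 1
  have a10 := h₀.apply 1 0
  have a11 := h₀.apply 1 1
  have b00 := h₁.apply 0 0
  have b01 := h₁.apply 0 1
  have b10 := h₁.apply 1 0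
  have b11 := h₁.apply 1 1
  have v0 := congrFun hv 0
  have v1 := congrFun hv 1
  clear hv
  subst hα'
  simp only [dotProduct, mulVec, Fin.sum_univ_two, Pi.star_apply, Matrix.sub_apply,
    Matrix.smul_apply, smul_eq_mul, det_fin_two, adjugate_fin_two, trace_fin_two, mul_apply,
    of_apply, cons_val_zero, cons_val_one, cons_val', cons_val_fin_one] at *
  have w0 := congrArg star v0
  have w1 := congrArg star v1
  have W0 := congrArg star hW0
  have W1 := congrArg star hW1
  simp only [star_add, star_mul', star_sub, star_star, star_neg, a00, a01, a10, a11, b00, b01, b10,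
    b11] at w0 w1 W0 W1 ⊢
  rw [w0, w1, v0, v1]
  clear v0 v1 w0 w1 a00 a01 a10 a11 b00 b01 b10 b11 h₀ h₁
  generalize star (α 0) = x at *
  generalize star (α 1) = y at *
  generalize star e = e' at *
  generalize Q₀ 0 0 = p at *
  generalize Q₀ 0 1 = b at *
  generalize Q₀ 1 0 = c at *
  generalize Q₀ 1 1 = r at *
  generalize Q₁ 0 0 = s at *
  generalize Q₁ 0 1 = f at *
  generalize Q₁ 1 0 = g at *
  generalize Q₁ 1 1 = u at *
  refine ⟨?_, ?_, by ring, by linear_combination e * W0 - W1⟩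
  · linear_combination (r * s - b * g - c * f + p * u - (e + e') * (p * r - b * c)) * hW1 +
      (x * (p * α 0 + b * α 1) + y * (c * α 0 + r * α 1)) * ((p * r - b * c) * hee + hdet)
  · linear_combination (r * s - b * g - c * f + p * u - (e + e') * (p * r - b * c)) * hW0 +
      (x * (p * α 0 + b * α 1) + y * (c * α 0 + r * α 1)) *
        ((r * s - b * g - c * f + p * u) * hee + (e + e') * hdet) -
      (x * (s * α 0 + f * α 1) + y * (g * α 0 + u * α 1)) * ((p * r - b * c) * hee + hdet)

theorem vecMulVec_gram_mulVec (α z : Fin 2 → ℂ) (Q : Matrix (Fin 2) (Fin 2) ℂ) :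
    ((vecMulVec (star α) α)ᵀ * Q) *ᵥ z = (star α ⬝ᵥ (Q *ᵥ z)) • α := by
  rw [transpose_vecMulVec, ← mulVec_mulVec, vecMulVec_mulVec]
  ext i
  simp [mul_comm]

/-- At every branch of nonzero weight, the Gram matrices of one party split into two parts that
are adapted to the gate. -/
theorem Balanced.exists_split {e : ℂ} {w : ℝ} {a b : ℕ} {A : Fin 2 → Matrix (Fin a) (Fin 2) ℂ}
    {B : Fin 2 → Matrix (Fin b) (Fin 2) ℂ} (h : Balanced e w (gram A) (gram B))
    (he : e ≠ 1) (he1 : ‖e‖ = 1) (hw : w ≠ 0) :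
    ∃ (α : Fin 2 → Fin 2 → Fin 2 → ℂ) (W : Fin 2 → ℝ),
      (∀ i, gram A i i = ∑ j, vecMulVec (star (α j i)) (α j i)) ∧ ∀ j,
        (∀ i k, star (α j i) ⬝ᵥ (gram B k k *ᵥ α j i) = W j) ∧
        star (α j 0) ⬝ᵥ (gram B 1 1 *ᵥ α j 1) = e * (star (α j 0) ⬝ᵥ (gram B 0 0 *ᵥ α j 1)) ∧
        (W j = 0 → α j = 0) ∧ (W j ≠ 0 → (of (α j)).det ≠ 0) := by
  have hwc : (w : ℂ) ≠ 0 := by exact_mod_cast hw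
  have hH : ∀ k, (gram B k k).IsHermitian := fun k => isHermitian_conjTranspose_mul_self _
  have hdet := h.symm.det_eq he hw
  -- The trace relations for i = 0 say exactly that P 0 0 has vanishing expectation against Q 0 0 −
  -- Q 1 1.
  obtain ⟨α₀, hα₀, hneut⟩ := exists_neutral_split (A 0) ((hH 0).sub (hH 1)) (by
    rw [Matrix.mul_sub, trace_sub, sub_eq_zero]
    exact (h.trace 0 0).trans (h.trace 0 1).symm)
  have hform : ∀ j, star (α₀ j) ⬝ᵥ (gram B 1 1 *ᵥ α₀ j) = star (α₀ j) ⬝ᵥ (gram B 0 0 *ᵥ α₀ j) := by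
    intro j
    have := hneut j
    rw [sub_mulVec, dotProduct_sub, sub_eq_zero] at this
    exact this.symm
  have hnn : ∀ j, 0 ≤ star (α₀ j) ⬝ᵥ (gram B 0 0 *ᵥ α₀ j) := fun j => star_dotProduct_gram_nonneg _ _
  obtain ⟨W, hW⟩ : ∃ W : Fin 2 → ℝ, ∀ j, star (α₀ j) ⬝ᵥ (gram B 0 0 *ᵥ α₀ j) = W j :=
    ⟨fun j => (star (α₀ j) ⬝ᵥ (gram B 0 0 *ᵥ α₀ j)).re, fun j =>
      (Complex.eq_re_of_ofReal_le (hnn j))⟩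
  have hW0 : ∀ j, 0 ≤ W j := fun j => by have := hnn j; rw [hW] at this; exact_mod_cast this
  have hWsum : ∑ j, (W j : ℂ) = w := by
    rw [← h.trace 0 0, gram, hα₀, transpose_sum, Matrix.sum_mul, trace_sum]
    refine Finset.sum_congr rfl fun j _ => ?_
    rw [transpose_vecMulVec, vecMulVec_mul, trace_vecMulVec, ← hW, dotProduct_mulVec, dotProduct_comm]
  -- The partner `β j` is orthogonal to this vector, which is the cross-term condition ⟨α₀, (Q 1 1 −
  -- e Q 0 0) β⟩ = 0.
  let v : Fin 2 → Fin 2 → ℂ := fun j => (gram B 1 1 - star e • gram B 0 0) *ᵥ α₀ j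
  let β : Fin 2 → Fin 2 → ℂ := fun j => ![star (v j 1), -star (v j 0)]
  have hpart := fun j => partner_form he1 (hH 0) (hH 1) hdet (α₀ j) (v j) (β j)
    (hW j) ((hform j).trans (hW j)) rfl rfl
  set κ : ℂ := ((gram B 0 0).adjugate * gram B 1 1).trace - (e + star e) * (gram B 0 0).det with hκ
  -- Given equal determinants, det(e Q 1 1 − Q 0 0) = −e κ.
  have hκ0 : κ ≠ 0 := by
    intro h0
    apply h.det_ne_zero he he1 hw
    have hee := star_mul_self_of_norm_eq_one he1
    rw [hκ] at h0
    rw [det_fin_two, det_fin_two] at hdet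
    simp only [det_fin_two, adjugate_fin_two, trace_fin_two, mul_apply, Fin.sum_univ_two, of_apply,
      cons_val_zero, cons_val_one, cons_val', cons_val_fin_one] at h0
    simp only [det_fin_two, Matrix.sub_apply, Matrix.smul_apply, smul_eq_mul]
    linear_combination -e * h0 - e ^ 2 * hdet
      - (gram B 0 0 0 0 * gram B 0 0 1 1 - gram B 0 0 0 1 * gram B 0 0 1 0) * hee
  -- The weights sum to w ≠ 0, so some W j is positive, and κ W j is a value of a nonnegative form.
  have hκpos : 0 ≤ κ := by
    obtain ⟨j, hj⟩ : ∃ j, W j ≠ 0 := by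
      by_contra! hall
      rw [← hWsum] at hwc
      simp [hall] at hwc
    have hj' : 0 < W j := lt_of_le_of_ne (hW0 j) (Ne.symm hj)
    have h1 : 0 ≤ κ * W j := by
      rw [← (hpart j).1]
      exact star_dotProduct_gram_nonneg _ _
    have h2 : κ = (κ * W j) * ((W j)⁻¹ : ℝ) := by
      have : (W j : ℂ) ≠ 0 := by exact_mod_cast hj
      push_cast
      field_simp
    rw [h2]
    exact mul_nonneg h1 (by exact_mod_cast (inv_pos.2 hj').le)
  obtain ⟨r, hr0, hr⟩ : ∃ r : ℝ, r ≠ 0 ∧ ((r * r : ℝ) : ℂ) * κ = 1 := by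
    have hre : κ = (κ.re : ℂ) := Complex.eq_re_of_ofReal_le hκpos
    have hpos : 0 < κ.re := by
      rcases lt_or_eq_of_le (Complex.le_def.1 hκpos).1 with h | h
      · exact h
      · rw [hre, ← h] at hκ0; simp at hκ0
    have hs : √κ.re ≠ 0 := (Real.sqrt_pos.2 hpos).ne'
    refine ⟨(√κ.re)⁻¹, inv_ne_zero hs, ?_⟩
    rw [hre, ← Complex.ofReal_mul, ← mul_inv, Complex.ofReal_re, Real.mul_self_sqrt hpos.le,
      inv_mul_cancel₀ hpos.ne', Complex.ofReal_one]
  -- Rescaling the partner by κ^(−1/2) turns its form values κ W j into W j.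
  let α : Fin 2 → Fin 2 → Fin 2 → ℂ := fun j => ![α₀ j, (r : ℂ) • β j]
  have hval : ∀ j i k, star (α j i) ⬝ᵥ (gram B k k *ᵥ α j i) = W j := by
    intro j i k
    fin_cases i
    · fin_cases k
      · exact hW j
      · exact (hform j).trans (hW j)
    · have : ∀ x, x = κ * (W j : ℂ) → (r : ℂ) * (r * x) = W j := by
        rintro x rfl
        push_cast at hr
        linear_combination (W j : ℂ) * hr
      have hsm : ∀ N : Matrix (Fin 2) (Fin 2) ℂ,
          star ((r : ℂ) • β j) ⬝ᵥ (N *ᵥ ((r : ℂ) • β j)) = r * (r * (star (β j) ⬝ᵥ (N *ᵥ β j))) := by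
        intro N
        have : star (r : ℂ) = r := by simp
        simp only [star_smul, mulVec_smul, smul_dotProduct, dotProduct_smul, smul_eq_mul, this]
      fin_cases k
      · exact (hsm _).trans (this _ (hpart j).1)
      · exact (hsm _).trans (this _ (hpart j).2.1)
  have hcross : ∀ j, star (α j 0) ⬝ᵥ (gram B 1 1 *ᵥ α j 1) =
      e * (star (α j 0) ⬝ᵥ (gram B 0 0 *ᵥ α j 1)) := by
    intro j
    have := (hpart j).2.2.1
    simp only [α, mulVec_smul, cons_val_zero, cons_val_one, dotProduct_smul, this, smul_eq_mul]
    ring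
  have hzero : ∀ j, W j = 0 → α j = 0 := by
    intro j hj
    have z : ∀ k, gram B k k *ᵥ α₀ j = 0 := by
      intro k
      apply gram_mulVec_eq_zero
      have := hval j 0 k
      rw [hj, Complex.ofReal_zero] at this
      exact this
    have z0 : α₀ j = 0 := h.eq_zero_of_mulVec he hw (z 0) (z 1)
    have z1 : v j = 0 := by simp [v, z0]
    funext i
    fin_cases i
    · simp [α, z0]
    · ext l
      fin_cases l <;> simp [α, β, z1]
  have hdetα : ∀ j, W j ≠ 0 → (of (α j)).det ≠ 0 := by
    intro j hj
    have := (hpart j).2.2.2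
    rw [det_fin_two]
    have h2 : of (α j) 0 0 * of (α j) 1 1 - of (α j) 0 1 * of (α j) 1 0 =
        r * ((e - 1) * star (W j : ℂ)) := by
      rw [← this]
      simp [α]
      ring
    rw [h2]
    refine mul_ne_zero (by exact_mod_cast hr0) (mul_ne_zero (sub_ne_zero.2 he) ?_)
    simpa using hj
  refine ⟨α, W, ?_, fun j => ⟨hval j, hcross j, hzero j, hdetα j⟩⟩
  -- Each part obeys the quadratic relation by itself with weight W j; this is checked on the basis
  -- α j 0, α j 1.
  have hq : ∀ j, e • ((vecMulVec (star (α j 0)) (α j 0))ᵀ * gram B 0 0 +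
        (vecMulVec (star (α j 1)) (α j 1))ᵀ * gram B 1 1) -
      ((vecMulVec (star (α j 0)) (α j 0))ᵀ * gram B 1 1 +
        (vecMulVec (star (α j 1)) (α j 1))ᵀ * gram B 0 0) =
      ((W j : ℂ) * (e - 1)) • (1 : Matrix (Fin 2) (Fin 2) ℂ) := by
    intro j
    by_cases hj : W j = 0
    · simp [hzero j hj, hj]
    · rw [← sub_eq_zero]
      refine eq_zero_of_mul_eq_zero_right (S := (of (α j))ᵀ) (by rw [det_transpose]; exact hdetα j hj) ?_
      have hcross' : e * (star (α j 1) ⬝ᵥ (gram B 1 1 *ᵥ α j 0)) =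
          star (α j 1) ⬝ᵥ (gram B 0 0 *ᵥ α j 0) := by
        have hs : ∀ k, star (star (α j 0) ⬝ᵥ (gram B k k *ᵥ α j 1)) =
            star (α j 1) ⬝ᵥ (gram B k k *ᵥ α j 0) := by
          intro k
          rw [gram, star_dotProduct_gram, star_dotProduct_gram, ← star_dotProduct_star, star_star,
            dotProduct_comm]
        have h1 := congrArg star (hcross j)
        rw [star_mul', hs, hs] at h1
        rw [h1, ← mul_assoc, mul_comm e, star_mul_self_of_norm_eq_one he1, one_mul]
      have hcol : ∀ i, (e • ((vecMulVec (star (α j 0)) (α j 0))ᵀ * gram B 0 0 +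
            (vecMulVec (star (α j 1)) (α j 1))ᵀ * gram B 1 1) -
          ((vecMulVec (star (α j 0)) (α j 0))ᵀ * gram B 1 1 +
            (vecMulVec (star (α j 1)) (α j 1))ᵀ * gram B 0 0) -
          ((W j : ℂ) * (e - 1)) • (1 : Matrix (Fin 2) (Fin 2) ℂ)) *ᵥ α j i = 0 := by
        intro i
        simp only [sub_mulVec, smul_mulVec, add_mulVec, vecMulVec_gram_mulVec, one_mulVec]
        fin_cases i
        · simp only [Fin.zero_eta, hval, ← hcross']
          module
        · simp only [Fin.mk_one, hval, hcross]
          module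
      ext l i
      have := congrFun (hcol i) l
      rw [mul_apply]
      exact this
  have h0 : gram A 0 0 = ∑ j, vecMulVec (star (α j 0)) (α j 0) := hα₀
  intro i
  fin_cases i
  · exact h0
  -- The partners were built from P 0 0 alone. Subtracting the summed relations `hq` from that of P
  -- leaves the discrepancy in P 1 1 times the invertible e Q 1 1 − Q 0 0.
  · rw [← sub_eq_zero, ← transpose_eq_zero]
    refine eq_zero_of_mul_eq_zero_right (h.det_ne_zero he he1 hw) ?_
    have q := h.quad
    rw [h0, ← hWsum, Finset.sum_mul, Finset.sum_smul, ← Finset.sum_congr rfl fun j _ => hq j] at q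
    simp only [Fin.sum_univ_two, Fin.mk_one, transpose_sub, transpose_add, Matrix.sub_mul,
      Matrix.add_mul, Matrix.mul_sub, Matrix.mul_smul] at q ⊢
    rw [← sub_eq_zero] at q
    rw [← q]
    module

/-- Splitting a pair of vectors with equal norms into parts with unit relative phase. -/
theorem exists_phase_split {e : ℂ} (he1 : ‖e‖ = 1) {b : ℕ} {B : Fin 2 → Matrix (Fin b) (Fin 2) ℂ}
    {α : Fin 2 → Fin 2 → ℂ} {W : ℝ}
    (hW : ∀ i k, star (α i) ⬝ᵥ (gram B k k *ᵥ α i) = W)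
    (hcross : star (α 0) ⬝ᵥ (gram B 1 1 *ᵥ α 1) = e * (star (α 0) ⬝ᵥ (gram B 0 0 *ᵥ α 1)))
    (hdet : (of α).det ≠ 0) :
    ∃ (β : Fin 2 → Fin 2 → Fin 2 → ℂ) (c : Fin 2 → ℂ) (μ : Fin 2 → ℂ),
      (∀ m, ‖μ m‖ = 1) ∧ (∀ k, gram B k k = ∑ m, vecMulVec (star (β m k)) (β m k)) ∧
      ∀ m i k, α i ⬝ᵥ β m k = c m * (if i = 1 then μ m else 1) * phase e i k := by
  have hee := star_mul_self_of_norm_eq_one he1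
  obtain ⟨u, hu, hz⟩ := exists_unit_mul_eq_norm (star (α 0) ⬝ᵥ (gram B 0 0 *ᵥ α 1))
  have huu := star_mul_self_of_norm_eq_one hu
  set z := star (α 0) ⬝ᵥ (gram B 0 0 *ᵥ α 1) with hzdef
  have hs : ∀ k, star (star (α 0) ⬝ᵥ (gram B k k *ᵥ α 1)) =
      star (α 1) ⬝ᵥ (gram B k k *ᵥ α 0) := by
    intro k
    rw [gram, star_dotProduct_gram, star_dotProduct_gram, ← star_dotProduct_star, star_star,
      dotProduct_comm]
  -- Positivity of the form at u α 0 − α 1, where its value is 2 (W − |z|).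
  have hle : ‖z‖ ≤ W := by
    have h1 := star_dotProduct_gram_nonneg (B 0) (u • α 0 - α 1)
    have h2 : star (u • α 0 - α 1) ⬝ᵥ (((B 0)ᴴ * B 0) *ᵥ (u • α 0 - α 1)) =
        ((2 * (W - ‖z‖) : ℝ) : ℂ) := by
      have e1 := hW 0 0
      have e2 := hW 1 0
      have e3 := hs 0
      rw [← hzdef, hz, star_mul'] at e3
      rw [hzdef, gram] at hz
      rw [gram] at e1 e2 e3
      simp only [mulVec_sub, mulVec_smul, star_sub, star_smul, sub_dotProduct, dotProduct_sub,
        smul_dotProduct, dotProduct_smul, smul_eq_mul, e1, e2, ← e3]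
      rw [hz, ← gram, ← hzdef]
      push_cast
      have : star ((‖z‖ : ℝ) : ℂ) = ‖z‖ := by simp
      rw [this]
      linear_combination ((W : ℂ) - 2 * ‖z‖) * huu
    rw [h2] at h1
    have h3 : (0 : ℝ) ≤ 2 * (W - ‖z‖) := by exact_mod_cast h1
    linarith
  let t : Fin 2 → ℝ := ![1, -1]
  -- In the basis α the form for k has diagonal W and off-diagonal entry `phase e 1 k * z`. It is a
  -- mixture of the rank-one forms of (1, ± u phase), with weights (W ± |z|)/2; `hle` makes them
  -- nonnegative.
  let c : Fin 2 → ℝ := fun m => √((W + t m * ‖z‖) / 2)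
  have hc : ∀ m, (c m : ℂ) * c m = (W + t m * ‖z‖) / 2 := by
    intro m
    rw [← Complex.ofReal_mul, Real.mul_self_sqrt]
    · push_cast; ring
    · have := norm_nonneg z
      fin_cases m <;> simp [t] <;> linarith
  have hdet' : IsUnit (of α)ᵀ.det := by rw [det_transpose]; exact isUnit_iff_ne_zero.2 hdet
  let γ : Fin 2 → Fin 2 → Fin 2 → ℂ := fun m k i =>
    c m * (if i = 1 then t m * u else 1) * phase e i k
  -- The vectors with prescribed pairings γ against the basis α.
  let β : Fin 2 → Fin 2 → Fin 2 → ℂ := fun m k => γ m k ᵥ* ((of α)ᵀ)⁻¹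
  have hβ : ∀ m i k, β m k ⬝ᵥ α i = γ m k i := by
    intro m i k
    have : β m k ᵥ* (of α)ᵀ = γ m k := by
      simp only [β]
      rw [vecMul_vecMul, nonsing_inv_mul _ hdet', vecMul_one]
    exact congrFun this i
  refine ⟨β, fun m => c m, fun m => t m * u, fun m => ?_, fun k => ?_, fun m i k => ?_⟩
  · fin_cases m <;> simp [t, hu]
  · rw [← sub_eq_zero]
    refine eq_zero_of_mul_eq_zero_right (S := (of α)ᵀ) (by rw [det_transpose]; exact hdet) ?_
    refine eq_zero_of_mul_eq_zero_left (S := ((of α)ᵀ)ᴴ)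
      (by rw [det_conjTranspose, det_transpose]; simpa using hdet) ?_
    ext i i'
    have hent : ∀ N : Matrix (Fin 2) (Fin 2) ℂ, (((of α)ᵀ)ᴴ * (N * (of α)ᵀ)) i i' =
        star (α i) ⬝ᵥ (N *ᵥ α i') := by
      intro N
      simp only [mul_apply, conjTranspose_apply, transpose_apply, of_apply, dotProduct, mulVec,
        Pi.star_apply]
    have hv : ∀ m, star (α i) ⬝ᵥ (vecMulVec (star (β m k)) (β m k) *ᵥ α i') =
        star (γ m k i) * γ m k i' := by
      intro m
      rw [vecMulVec_mulVec, hβ, ← hβ m i k, ← star_dotProduct_star, dotProduct_smul,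
        MulOpposite.smul_eq_mul_unop, MulOpposite.unop_op]
    rw [hent, sub_mulVec, dotProduct_sub, sum_mulVec, dotProduct_sum]
    simp only [hv, Fin.sum_univ_two]
    have hc0 := hc 0
    have hc1 := hc 1
    have hsc : ∀ m, star (c m : ℂ) = c m := by intro m; simp
    have hcr : star (α 0) ⬝ᵥ (gram B k k *ᵥ α 1) = phase e 1 k * z := by
      fin_cases k
      · simp [phase, hzdef]
      · simpa [phase] using hcross
    have hcr' := hs k
    rw [hcr] at hcr'
    have hzz : star z = ‖z‖ * star u := by
      conv_lhs => rw [hz]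
      simp
    have hpp : star (phase e 1 k) * phase e 1 k = 1 := by
      unfold phase
      split_ifs
      · exact hee
      · simp
    have hp0 : phase e 0 k = 1 := by simp [phase]
    have t0 : (t 0 : ℂ) = 1 := by simp [t]
    have t1 : (t 1 : ℂ) = -1 := by simp [t]
    rw [t0] at hc0
    rw [t1] at hc1
    have i01 : ¬ ((0 : Fin 2) = 1) := by decide
    fin_cases i <;> fin_cases i' <;>
      simp only [γ, Fin.zero_eta, Fin.mk_one, hW, hcr, ← hcr', star_mul', hzz, i01, if_true, if_false,
        star_one, hsc, hp0, t0, t1, star_neg, Matrix.zero_apply, mul_one]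
    · linear_combination -hc0 - hc1
    · rw [hz]
      linear_combination -u * phase e 1 k * (hc0 - hc1)
    · linear_combination -star u * star (phase e 1 k) * (hc0 - hc1)
    · linear_combination -(hc0 + hc1) * (star u * u * star (phase e 1 k) * phase e 1 k)
        - W * star u * u * hpp - W * huu
  · rw [dotProduct_comm, hβ]

/-! ### Existence of measurements -/

/-- A Hermitian matrix has a Hermitian pseudo-inverse. -/
theorem exists_pseudoinverse {κ : Type} [Fintype κ] [DecidableEq κ] {G : Matrix κ κ ℂ}
    (hG : G.IsHermitian) : ∃ R : Matrix κ κ ℂ, Rᴴ = R ∧ G * R * G = G ∧ R * G * R = R := by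
  obtain ⟨U, g, hU, rfl⟩ : ∃ (U : Matrix κ κ ℂ) (g : κ → ℝ), Uᴴ * U = 1 ∧
      G = U * diagonal (fun i => (g i : ℂ)) * Uᴴ := by
    refine ⟨hG.eigenvectorUnitary, hG.eigenvalues, Unitary.coe_star_mul_self _, ?_⟩
    have := hG.spectral_theorem
    rw [Unitary.conjStarAlgAut_apply] at this
    exact this
  have hmul : ∀ f g : κ → ℂ, (U * diagonal f * Uᴴ) * (U * diagonal g * Uᴴ) =
      U * diagonal (fun i => f i * g i) * Uᴴ := by
    intro f g
    calc (U * diagonal f * Uᴴ) * (U * diagonal g * Uᴴ)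
        = U * diagonal f * (Uᴴ * U) * diagonal g * Uᴴ := by simp only [Matrix.mul_assoc]
      _ = _ := by rw [hU, Matrix.mul_one, Matrix.mul_assoc U, diagonal_mul_diagonal]
  -- Zero eigenvalues are left at zero because 0⁻¹ = 0.
  refine ⟨U * diagonal (fun i => (((g i)⁻¹ : ℝ) : ℂ)) * Uᴴ, ?_, ?_, ?_⟩
  · simp only [conjTranspose_mul, conjTranspose_conjTranspose, diagonal_conjTranspose,
      Matrix.mul_assoc]
    congr 3
    funext i
    simp
  · rw [hmul, hmul]
    congr 3
    funext i
    by_cases h : g i = 0 <;> simp [h]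
  · rw [hmul, hmul]
    congr 3
    funext i
    by_cases h : g i = 0 <;> simp [h]

/-- Operators with prescribed values `N j` on the range of `T` exist and can be completed to a
measurement by operators vanishing on the range of `T`. -/
theorem exists_measurement_of_gram {a : ℕ} {ι κ : Type} [Fintype ι] [Fintype κ] [DecidableEq κ]
    (T : Matrix (Fin a) κ ℂ) (N : ι → Matrix (Fin 2) κ ℂ) (h : ∑ j, (N j)ᴴ * N j = Tᴴ * T) :
    ∃ M : ι ⊕ Fin a → Matrix (Fin 2) (Fin a) ℂ, ∑ s, (M s)ᴴ * M s = 1 ∧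
      (∀ j, M (Sum.inl j) * T = N j) ∧ ∀ l, M (Sum.inr l) * T = 0 := by
  obtain ⟨R, hR, hGRG, hRGR⟩ := exists_pseudoinverse (isHermitian_conjTranspose_mul_self T)
  set G := Tᴴ * T with hG
  have hGh : Gᴴ = G := isHermitian_conjTranspose_mul_self T
  -- The orthogonal projection onto the range of `T`.
  let Pr : Matrix (Fin a) (Fin a) ℂ := T * R * Tᴴ
  have hPrh : Prᴴ = Pr := by
    simp only [Pr, conjTranspose_mul, conjTranspose_conjTranspose, hR, Matrix.mul_assoc]
  have hPrT : Pr * T = T := by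
    have h1 : (T * (R * G) - T)ᴴ * (T * (R * G) - T) = 0 := by
      have : (T * (R * G) - T)ᴴ * (T * (R * G) - T) =
          (G * R * G) * R * G - G * R * G - G * R * G + G := by
        simp only [conjTranspose_sub, conjTranspose_mul, hR, hGh, Matrix.sub_mul, Matrix.mul_sub]
        rw [hG]
        simp only [Matrix.mul_assoc]
        abel
      rw [this, hGRG, hGRG]
      abel
    have h2 := conjTranspose_mul_self_eq_zero.1 h1
    rw [sub_eq_zero] at h2
    simpa only [Pr, Matrix.mul_assoc] using h2
  -- By `h`, each `N j` vanishes on the kernel of `T`: the summed squares of N j (R G − 1) equal (G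
  -- R − 1) G (R G − 1) = 0.
  have hNT : ∀ j, N j * (R * G) = N j := by
    intro j
    have h1 : ∑ j, (N j * (R * G) - N j)ᴴ * (N j * (R * G) - N j) = 0 := by
      have : ∀ j, (N j * (R * G) - N j)ᴴ * (N j * (R * G) - N j) =
          (G * R - 1) * ((N j)ᴴ * N j) * (R * G - 1) := by
        intro j
        simp only [conjTranspose_sub, conjTranspose_mul, hR, hGh, Matrix.sub_mul, Matrix.mul_sub,
          Matrix.mul_assoc, Matrix.one_mul, Matrix.mul_one]
      simp only [this]
      rw [← Matrix.sum_mul, ← Matrix.mul_sum, h]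
      rw [Matrix.sub_mul, hGRG, Matrix.one_mul, sub_self, Matrix.zero_mul]
    have h2 := (Finset.sum_eq_zero_iff_of_nonneg fun j _ =>
      (posSemidef_conjTranspose_mul_self (N j * (R * G) - N j)).nonneg).1 h1 j (Finset.mem_univ j)
    exact sub_eq_zero.1 (conjTranspose_mul_self_eq_zero.1 h2)
  have hPr2 : Pr * Pr = Pr := by
    calc Pr * Pr = T * (R * G * R) * Tᴴ := by simp only [Pr, hG, Matrix.mul_assoc]
      _ = Pr := by rw [hRGR]
  let C : Matrix (Fin a) (Fin a) ℂ := 1 - Pr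
  have hCC : Cᴴ * C = C := by
    simp only [C, conjTranspose_sub, conjTranspose_one, hPrh, Matrix.sub_mul, Matrix.mul_sub, hPr2,
      Matrix.one_mul, Matrix.mul_one]
    abel
  have hCT : C * T = 0 := by
    simp only [C, Matrix.sub_mul, Matrix.one_mul, hPrT, sub_self]
  -- The complement C = 1 − Pr is implemented row by row as |0⟩⟨l| C, so that these outcomes also
  -- leave a qubit.
  refine ⟨Sum.elim (fun j => N j * R * Tᴴ) fun l => of fun x y => if x = 0 then C l y else 0,
    ?_, fun j => ?_, fun l => ?_⟩
  · rw [Fintype.sum_sum_type]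
    simp only [Sum.elim_inl, Sum.elim_inr]
    have h1 : ∑ j, (N j * R * Tᴴ)ᴴ * (N j * R * Tᴴ) = Pr := by
      have : ∀ j, (N j * R * Tᴴ)ᴴ * (N j * R * Tᴴ) = T * R * ((N j)ᴴ * N j) * (R * Tᴴ) := by
        intro j
        simp only [conjTranspose_mul, conjTranspose_conjTranspose, hR, Matrix.mul_assoc]
      simp only [this]
      rw [← Matrix.sum_mul, ← Matrix.mul_sum, h]
      calc T * R * G * (R * Tᴴ) = T * (R * G * R) * Tᴴ := by simp only [Matrix.mul_assoc]
        _ = Pr := by rw [hRGR]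
    have h2 : ∑ l, (of fun (x : Fin 2) y => if x = 0 then C l y else 0)ᴴ *
        (of fun (x : Fin 2) y => if x = 0 then C l y else 0) = C := by
      conv_rhs => rw [← hCC]
      ext x y
      simp [Matrix.sum_apply, mul_apply]
    rw [h1, h2]
    simp [C]
  · simp only [Sum.elim_inl]
    calc N j * R * Tᴴ * T = N j * (R * G) := by simp only [hG, Matrix.mul_assoc]
      _ = N j := hNT j
  · ext x y
    have := congrFun (congrFun hCT l) y
    rw [mul_apply] at this
    by_cases hx : x = 0
    · simpa [mul_apply, hx] using this
    · simp [mul_apply, hx]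

/-- The local operators of a branch in which the party's qubit is diagonal in the input basis. -/
def diagRow (α : Fin 2 → Fin 2 → ℂ) (i : Fin 2) : Matrix (Fin 2) (Fin 2) ℂ :=
  of fun x l => if x = i then α i l else 0

/-- A measurement that splits a block-diagonal family of Gram matrices into rank-one parts. -/
theorem exists_measurement {a : ℕ} (A : Fin 2 → Matrix (Fin a) (Fin 2) ℂ)
    (α : Fin 2 → Fin 2 → Fin 2 → ℂ)
    (hoff : ∀ i i', i ≠ i' → gram A i i' = 0)
    (hdiag : ∀ i, gram A i i = ∑ j, vecMulVec (star (α j i)) (α j i)) :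
    ∃ M : Fin 2 ⊕ Fin a → Matrix (Fin 2) (Fin a) ℂ, ∑ s, (M s)ᴴ * M s = 1 ∧
      (∀ j i, M (Sum.inl j) * A i = diagRow (α j) i) ∧ ∀ l i, M (Sum.inr l) * A i = 0 := by
  -- Placing the blocks side by side turns conditions on all Gram blocks into one condition on a
  -- single Gram matrix.
  let flat : ∀ {m : ℕ}, (Fin 2 → Matrix (Fin m) (Fin 2) ℂ) → Matrix (Fin m) (Fin 2 × Fin 2) ℂ :=
    fun F => of fun x il => F il.1 x il.2
  have hflat : ∀ {m m' : ℕ} (X : Matrix (Fin m') (Fin m) ℂ) (F : Fin 2 → Matrix (Fin m) (Fin 2) ℂ) i x l,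
      (X * F i) x l = (X * flat F) x (i, l) := fun X F i x l => rfl
  have hgram : ∀ {m : ℕ} (F : Fin 2 → Matrix (Fin m) (Fin 2) ℂ) i i' l l',
      ((flat F)ᴴ * flat F) (i, l) (i', l') = gram F i i' l l' := fun F i i' l l' => rfl
  obtain ⟨M, h1, h2, h3⟩ := exists_measurement_of_gram (flat A)
    (fun j : Fin 2 => flat (diagRow (α j))) (by
      ext ⟨i, l⟩ ⟨i', l'⟩
      rw [Matrix.sum_apply, hgram]
      simp only [hgram]
      by_cases hi : i = i'
      · subst hi
        rw [hdiag, Matrix.sum_apply]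
        refine Finset.sum_congr rfl fun j _ => ?_
        simp [gram, diagRow, mul_apply, vecMulVec_apply]
      · rw [hoff i i' hi]
        refine Finset.sum_eq_zero fun j _ => ?_
        simp [gram, diagRow, mul_apply, Ne.symm hi])
  refine ⟨M, h1, fun j i => ?_, fun l i => ?_⟩
  · ext x l
    rw [hflat, h2]
    rfl
  · ext x y
    rw [hflat, h3]
    rfl

/-! ### Building protocols -/

theorem exists_alice {n b a : ℕ} {ι : Type} [Fintype ι] (M : ι → Matrix (Fin 2) (Fin a) ℂ)
    (hM : ∑ s, (M s)ᴴ * M s = 1) (next : ι → Protocol n 2 b) (t : List Party)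
    (ht : ∀ s, (next s).Follows t) :
    ∃ P : Protocol (n + 1) a b, P.Follows (Party.alice :: t) ∧ ∀ σ, P.run σ =
      ∑ s, (next s).run ((M s ⊗ₖ (1 : Matrix (Fin b) (Fin b) ℂ)) * σ *
        (M s ⊗ₖ (1 : Matrix (Fin b) (Fin b) ℂ))ᴴ) := by
  let f := (Fintype.equivFin ι).symm
  refine ⟨.alice (Fintype.card ι) (fun _ => 2) (fun i => M (f i)) ?_ (fun i => next (f i)), ?_, ?_⟩
  · rw [← hM]
    exact Equiv.sum_comp f fun s => (M s)ᴴ * M s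
  · exact ⟨t, rfl, fun i => ht _⟩
  · intro σ
    rw [Protocol.run]
    exact Equiv.sum_comp f fun s => (next s).run ((M s ⊗ₖ (1 : Matrix (Fin b) (Fin b) ℂ)) * σ *
        (M s ⊗ₖ (1 : Matrix (Fin b) (Fin b) ℂ))ᴴ)

theorem exists_bob {n b a : ℕ} {ι : Type} [Fintype ι] (K : ι → Matrix (Fin 2) (Fin b) ℂ)
    (hK : ∑ s, (K s)ᴴ * K s = 1) (next : ι → Protocol n a 2) (t : List Party)
    (ht : ∀ s, (next s).Follows t) :
    ∃ P : Protocol (n + 1) a b, P.Follows (Party.bob :: t) ∧ ∀ σ, P.run σ =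
      ∑ s, (next s).run (((1 : Matrix (Fin a) (Fin a) ℂ) ⊗ₖ K s) * σ *
        ((1 : Matrix (Fin a) (Fin a) ℂ) ⊗ₖ K s)ᴴ) := by
  let f := (Fintype.equivFin ι).symm
  refine ⟨.bob (Fintype.card ι) (fun _ => 2) (fun i => K (f i)) ?_ (fun i => next (f i)), ?_, ?_⟩
  · rw [← hK]
    exact Equiv.sum_comp f fun s => (K s)ᴴ * K s
  · exact ⟨t, rfl, fun i => ht _⟩
  · intro σ
    rw [Protocol.run]
    exact Equiv.sum_comp f fun s => (next s).run (((1 : Matrix (Fin a) (Fin a) ℂ) ⊗ₖ K s) * σ *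
        ((1 : Matrix (Fin a) (Fin a) ℂ) ⊗ₖ K s)ᴴ)

/-- Supplies filler turns: branches of zero weight must still have the prescribed length and order.
-/
theorem exists_measurement_to_qubit (a : ℕ) :
    ∃ M : Fin a → Matrix (Fin 2) (Fin a) ℂ, ∑ s, (M s)ᴴ * M s = 1 := by
  refine ⟨fun l => Matrix.single 0 l 1, ?_⟩
  have : ∀ l : Fin a, (Matrix.single (0 : Fin 2) l (1 : ℂ))ᴴ *
      Matrix.single (0 : Fin 2) l (1 : ℂ) = Matrix.single l l (1 : ℂ) := by
    intro l
    rw [conjTranspose_single, star_one, single_mul_single_same, mul_one]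
  simp only [this]
  rw [sum_single_one]

theorem Protocol.done_follows : Protocol.done.Follows [] := rfl

theorem exists_follows_alice : ∃ P : Protocol 1 2 2, P.Follows [Party.alice] := by
  obtain ⟨M, hM⟩ := exists_measurement_to_qubit 2
  obtain ⟨P, hP, -⟩ := exists_alice M hM (fun _ => Protocol.done) [] fun _ => Protocol.done_follows
  exact ⟨P, hP⟩

theorem exists_follows_bob_alice (b : ℕ) :
    ∃ P : Protocol 2 2 b, P.Follows [Party.bob, Party.alice] := by
  obtain ⟨M, hM⟩ := exists_measurement_to_qubit b
  obtain ⟨R, hR⟩ := exists_follows_alice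
  obtain ⟨P, hP, -⟩ := exists_bob M hM (fun _ => R) _ fun _ => hR
  exact ⟨P, hP⟩

theorem exists_follows_alice_bob_alice (a b : ℕ) :
    ∃ P : Protocol 3 a b, P.Follows [Party.alice, Party.bob, Party.alice] := by
  obtain ⟨M, hM⟩ := exists_measurement_to_qubit a
  obtain ⟨R, hR⟩ := exists_follows_bob_alice b
  obtain ⟨P, hP, -⟩ := exists_alice M hM (fun _ => R) _ fun _ => hR
  exact ⟨P, hP⟩

/-- The continuations may realize the gate with any weights, which simply add; the total is
identified later by `weight_unique`. -/
theorem exists_alice_realizes {n b a : ℕ} {A : Fin 2 → Matrix (Fin a) (Fin 2) ℂ}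
    {B : Fin 2 → Matrix (Fin b) (Fin 2) ℂ} {U : Matrix (Fin 2 × Fin 2) (Fin 2 × Fin 2) ℂ}
    {ι : Type} [Fintype ι] (M : ι → Matrix (Fin 2) (Fin a) ℂ)
    (hM : ∑ s, (M s)ᴴ * M s = 1) (t : List Party)
    (hnext : ∀ s, ∃ Q : Protocol n 2 b, Q.Follows t ∧
      ∃ w, Q.Realizes (pairOp (fun i => M s * A i) B) U w) :
    ∃ P : Protocol (n + 1) a b, P.Follows (Party.alice :: t) ∧
      ∃ w, P.Realizes (pairOp A B) U w := by
  choose next ht w hw using hnext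
  obtain ⟨P, hP, hrun⟩ := exists_alice M hM next t ht
  refine ⟨P, hP, ∑ s, w s, fun ρ hρ => ?_⟩
  rw [hrun, Complex.ofReal_sum, Finset.sum_smul]
  refine Finset.sum_congr rfl fun s _ => ?_
  rw [← hw s ρ hρ]
  have := kronecker_mul_pairOp (M s) (1 : Matrix (Fin b) (Fin b) ℂ) A B
  simp only [Matrix.one_mul] at this
  rw [← this]
  simp only [conjTranspose_mul, Matrix.mul_assoc]

theorem exists_bob_realizes {n b a : ℕ} {A : Fin 2 → Matrix (Fin a) (Fin 2) ℂ}
    {B : Fin 2 → Matrix (Fin b) (Fin 2) ℂ} {U : Matrix (Fin 2 × Fin 2) (Fin 2 × Fin 2) ℂ}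
    {ι : Type} [Fintype ι] (K : ι → Matrix (Fin 2) (Fin b) ℂ)
    (hK : ∑ s, (K s)ᴴ * K s = 1) (t : List Party)
    (hnext : ∀ s, ∃ Q : Protocol n a 2, Q.Follows t ∧
      ∃ w, Q.Realizes (pairOp A fun k => K s * B k) U w) :
    ∃ P : Protocol (n + 1) a b, P.Follows (Party.bob :: t) ∧
      ∃ w, P.Realizes (pairOp A B) U w := by
  choose next ht w hw using hnext
  obtain ⟨P, hP, hrun⟩ := exists_bob K hK next t ht
  refine ⟨P, hP, ∑ s, w s, fun ρ hρ => ?_⟩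
  rw [hrun, Complex.ofReal_sum, Finset.sum_smul]
  refine Finset.sum_congr rfl fun s _ => ?_
  rw [← hw s ρ hρ]
  have := kronecker_mul_pairOp (1 : Matrix (Fin a) (Fin a) ℂ) (K s) A B
  simp only [Matrix.one_mul] at this
  rw [← this]
  simp only [conjTranspose_mul, Matrix.mul_assoc]

theorem Protocol.realizes_of_eq_zero {n a b : ℕ} (P : Protocol n a b)
    {V : Matrix (Fin a × Fin b) (Fin 2 × Fin 2) ℂ} (hV : V = 0)
    (U : Matrix (Fin 2 × Fin 2) (Fin 2 × Fin 2) ℂ) : P.Realizes V U 0 := by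
  intro ρ _
  simp [hV, P.run_zero]

theorem pairOp_eq_zero {a b : ℕ} {A : Fin 2 → Matrix (Fin a) (Fin 2) ℂ}
    {B : Fin 2 → Matrix (Fin b) (Fin 2) ℂ} (h : ∀ i k, A i * (B k)ᵀ = 0) : pairOp A B = 0 := by
  ext ⟨x, y⟩ ⟨i, k⟩
  simp [pairOp, h]

/-- Alice's final phase correction. -/
theorem exists_alice_phase {θ : ℝ} {α β : Fin 2 → Fin 2 → ℂ} {c μ : ℂ} (hμ : ‖μ‖ = 1)
    (h : ∀ i k, α i ⬝ᵥ β k =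
      c * (if i = 1 then μ else 1) * phase (Complex.exp (θ * Complex.I)) i k) :
    ∃ P : Protocol 1 2 2, P.Follows [Party.alice] ∧
      ∃ w, P.Realizes (pairOp (diagRow α) (diagRow β)) (gate θ) w := by
  have hμμ := star_mul_self_of_norm_eq_one hμ
  -- A single outcome: Alice applies the unitary diag(1, μ̄).
  refine exists_alice_realizes (ι := Unit) (fun _ => diagonal ![1, star μ]) ?_ [] fun _ =>
    ⟨Protocol.done, Protocol.done_follows, ‖c‖ ^ 2, fun ρ _ => ?_⟩
  · simp only [Finset.univ_unique, Finset.sum_singleton, diagonal_conjTranspose,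
      diagonal_mul_diagonal, ← diagonal_one]
    congr 1
    funext i
    fin_cases i
    · simp
    · simpa [mul_comm] using hμμ
  · have hV : pairOp (fun i => diagonal ![1, star μ] * diagRow α i) (diagRow β) = c • gate θ := by
      ext ⟨x, y⟩ ⟨i, k⟩
      rw [Matrix.smul_apply, gate_apply]
      simp only [pairOp, of_apply, mul_apply, transpose_apply, diagRow]
      by_cases hx : x = i
      · by_cases hy : y = k
        · subst hx hy
          have h1 := h x y
          simp only [dotProduct, Fin.sum_univ_two] at h1
          fin_cases x
          · simp at h1 ⊢
            exact h1
          · simp at h1 ⊢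
            simp only [starRingEnd_apply]
            linear_combination star μ * h1 +
              c * phase (Complex.exp (θ * Complex.I)) 1 y * hμμ
        · simp [hy]
      · simp [hx]
    rw [Protocol.run, hV]
    have := sum_smul_conj (ι := Unit) (fun _ => c) (gate θ) ρ
    simpa using this

/-- The off-diagonal block is annihilated by both diagonal blocks of the other party, hence by their
invertible combination. -/
theorem Balanced.gram_offDiag {e : ℂ} {w : ℝ} {a : ℕ} {A : Fin 2 → Matrix (Fin a) (Fin 2) ℂ}
    {Q : Fin 2 → Fin 2 → Matrix (Fin 2) (Fin 2) ℂ}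
    (h : Balanced e w (gram A) Q) (he : e ≠ 1) (he1 : ‖e‖ = 1) (hw : w ≠ 0) {k k' : Fin 2}
    (hk : k ≠ k') : Q k k' = 0 := by
  refine eq_zero_of_mul_eq_zero_left (S := (e • gram A 1 1 - gram A 0 0)ᵀ) ?_ ?_
  · rw [det_transpose]
    exact h.symm.det_ne_zero he he1 hw
  · rw [transpose_sub, transpose_smul, Matrix.sub_mul, Matrix.smul_mul,
      h.offDiag 1 1 k k' (Or.inr hk), h.offDiag 0 0 k k' (Or.inr hk)]
    simp

/-- Every branch from which the gate can be implemented can be finished in three turns, in the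
order Alice, Bob, Alice. -/
theorem Balanced.exists_protocol {θ w : ℝ} {a b : ℕ} {A : Fin 2 → Matrix (Fin a) (Fin 2) ℂ}
    {B : Fin 2 → Matrix (Fin b) (Fin 2) ℂ} (hθ : Complex.exp (θ * Complex.I) ≠ 1)
    (h : Balanced (Complex.exp (θ * Complex.I)) w (gram A) (gram B)) (hw : w ≠ 0) :
    ∃ P : Protocol 3 a b, P.Follows [Party.alice, Party.bob, Party.alice] ∧
      ∃ w', P.Realizes (pairOp A B) (gate θ) w' := by
  have he1 := Complex.norm_exp_ofReal_mul_I θ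
  obtain ⟨α, W, hα, hprop⟩ := h.exists_split hθ he1 hw
  obtain ⟨M, hM, hMj, hM0⟩ := exists_measurement A α
    (fun i i' hi => h.symm.gram_offDiag hθ he1 hw hi) hα
  refine exists_alice_realizes M hM _ ?_
  have hzero : ∀ A' : Fin 2 → Matrix (Fin 2) (Fin 2) ℂ, A' = 0 →
      ∃ Q : Protocol 2 2 b, Q.Follows [Party.bob, Party.alice] ∧
        ∃ w, Q.Realizes (pairOp A' B) (gate θ) w := by
    rintro _ rfl
    obtain ⟨Q, hQ⟩ := exists_follows_bob_alice b
    exact ⟨Q, hQ, 0, Q.realizes_of_eq_zero (pairOp_eq_zero fun i k => by simp) _⟩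
  rintro (j | l)
  · obtain ⟨hval, hcross, hz, hdet⟩ := hprop j
    by_cases hj : W j = 0
    · apply hzero
      funext i
      rw [hMj, hz hj]
      ext x y
      simp [diagRow]
    · simp only [hMj]
      obtain ⟨β, c, μ, hμ, hβ, hc⟩ := exists_phase_split he1 hval hcross (hdet hj)
      obtain ⟨K, hK, hKm, hK0⟩ := exists_measurement B β
        (fun i i' hi => h.gram_offDiag hθ he1 hw hi) hβ
      refine exists_bob_realizes K hK _ ?_
      rintro (m | l)
      · simp only [hKm]
        exact exists_alice_phase (hμ m) (hc m)
      · obtain ⟨Q, hQ⟩ := exists_follows_alice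
        exact ⟨Q, hQ, 0, Q.realizes_of_eq_zero (pairOp_eq_zero fun i k => by simp [hK0]) _⟩
  · apply hzero
    funext i
    rw [hM0]
    rfl

/-- The trace in `Balanced` is a squared Hilbert–Schmidt norm. Hence weights are nonnegative, and
weight zero means that the branch operator vanishes. -/
theorem trace_gram_mul_gram {a b : ℕ} (A : Fin 2 → Matrix (Fin a) (Fin 2) ℂ)
    (B : Fin 2 → Matrix (Fin b) (Fin 2) ℂ) (i k : Fin 2) :
    ((gram A i i)ᵀ * gram B k k).trace = ((A i * (B k)ᵀ)ᴴ * (A i * (B k)ᵀ)).trace := by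
  calc ((gram A i i)ᵀ * gram B k k).trace = ((gram B k k)ᵀ * gram A i i).trace := by
        rw [← trace_transpose, transpose_mul, transpose_transpose]
    _ = ((B k)ᵀ * (((B k)ᵀ)ᴴ * gram A i i)).trace := by
        rw [← Matrix.mul_assoc, gram, transpose_mul]
        rfl
    _ = ((((B k)ᵀ)ᴴ * gram A i i) * (B k)ᵀ).trace := trace_mul_comm _ _
    _ = _ := by simp only [gram, conjTranspose_mul, Matrix.mul_assoc]

theorem Balanced.pairOp_eq_zero_of_weight {e : ℂ} {w : ℝ} {a b : ℕ}
    {A : Fin 2 → Matrix (Fin a) (Fin 2) ℂ} {B : Fin 2 → Matrix (Fin b) (Fin 2) ℂ}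
    (h : Balanced e w (gram A) (gram B)) (hw : w = 0) : pairOp A B = 0 := by
  refine pairOp_eq_zero fun i k => ?_
  have := h.trace i k
  rw [trace_gram_mul_gram, hw, Complex.ofReal_zero] at this
  exact trace_conjTranspose_mul_self_eq_zero_iff.1 this

/-- A branch from which the gate is implemented can be finished with the same weight in three
turns, in the order Alice, Bob, Alice. -/
theorem Protocol.Realizes.exists_alice_bob_alice {n a b : ℕ} {P : Protocol n a b} {θ w : ℝ}
    {A : Fin 2 → Matrix (Fin a) (Fin 2) ℂ} {B : Fin 2 → Matrix (Fin b) (Fin 2) ℂ}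
    (h : P.Realizes (pairOp A B) (gate θ) w) (hθ : Complex.exp (θ * Complex.I) ≠ 1) :
    ∃ Q : Protocol 3 a b, Q.Follows [Party.alice, Party.bob, Party.alice] ∧
      Q.Realizes (pairOp A B) (gate θ) w := by
  have hb := h.balanced hθ
  by_cases hw : w = 0
  · obtain ⟨Q, hQ⟩ := exists_follows_alice_bob_alice a b
    refine ⟨Q, hQ, ?_⟩
    rw [hw]
    exact Q.realizes_of_eq_zero (hb.pairOp_eq_zero_of_weight hw) _
  · obtain ⟨Q, hQ, w', hw'⟩ := hb.exists_protocol hθ hw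
    refine ⟨Q, hQ, ?_⟩
    rwa [h.weight_unique hw' (gate_conjTranspose_mul_self θ)]

/-! ### Resources of Schmidt number two -/

/-- A resource of Schmidt number two, written with local operators `E` and `F`. -/
theorem IsPureStateOfSchmidtNumber.exists_factorization {p q : ℕ}
    {ψ : EuclideanSpace ℂ (Fin p × Fin q)} (h : IsPureStateOfSchmidtNumber 2 ψ) :
    ∃ (E : Matrix (Fin p) (Fin 2) ℂ) (F : Matrix (Fin q) (Fin 2) ℂ),
      (∀ k l, ψ (k, l) = ∑ j, E k j * F l j) ∧ (Eᴴ * E).det ≠ 0 ∧ (Fᴴ * F).det ≠ 0 := by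
  obtain ⟨-, s, e, f, hs, he, hf, hψ⟩ := h
  have horth : ∀ {p : ℕ} (e : Fin 2 → EuclideanSpace ℂ (Fin p)), Orthonormal ℂ e →
      (of fun k j => e j k : Matrix (Fin p) (Fin 2) ℂ)ᴴ * (of fun k j => e j k) = 1 := by
    intro p e he
    ext i j
    have := orthonormal_iff_ite.1 he i j
    rw [EuclideanSpace.inner_eq_star_dotProduct] at this
    rw [one_apply, ← this, mul_apply]
    simp [dotProduct, mul_comm]
  refine ⟨(of fun k j => e j k) * diagonal fun j => (s j : ℂ), of fun l j => f j l, ?_, ?_, ?_⟩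
  · intro k l
    rw [hψ]
    refine Finset.sum_congr rfl fun j _ => ?_
    simp [mul_comm]
  · rw [conjTranspose_mul, Matrix.mul_assoc, ← Matrix.mul_assoc _ _ (diagonal _), horth e he,
      Matrix.one_mul, det_mul, det_conjTranspose, det_diagonal]
    have : ∏ j, (s j : ℂ) ≠ 0 := Finset.prod_ne_zero_iff.2 fun j _ => by
      exact_mod_cast (hs j).ne'
    exact mul_ne_zero (by simpa using this) this
  · rw [horth f hf]
    simp

theorem joint_eq_branchState {p q : ℕ} (ψ : EuclideanSpace ℂ (Fin p × Fin q))
    (ρ : Matrix (Fin 2 × Fin 2) (Fin 2 × Fin 2) ℂ) : joint ρ ψ = branchState ψ 1 1 ρ := by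
  simp [branchState]

theorem Protocol.implements_iff {n p q : ℕ} {P : Protocol n (2 * p) (2 * q)}
    {ψ : EuclideanSpace ℂ (Fin p × Fin q)} {U : Matrix (Fin 2 × Fin 2) (Fin 2 × Fin 2) ℂ}
    {E : Matrix (Fin p) (Fin 2) ℂ} {F : Matrix (Fin q) (Fin 2) ℂ}
    (hψ : ∀ k l, ψ (k, l) = ∑ j, E k j * F l j) :
    P.Implements ψ U ↔ P.Realizes (pairOp (inputBlock E 1) (inputBlock F 1)) U 1 := by
  simp only [Protocol.Implements, Protocol.Realizes, joint_eq_branchState, branchState_eq hψ,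
    Complex.ofReal_one, one_smul]

theorem kronecker_mul_pairOp_inputBlock {a b a' b' p q : ℕ} (X : Matrix (Fin a') (Fin a) ℂ)
    (Y : Matrix (Fin b') (Fin b) ℂ) (E : Matrix (Fin p) (Fin 2) ℂ) (F : Matrix (Fin q) (Fin 2) ℂ)
    (A : Matrix (Fin a) (Fin (2 * p)) ℂ) (B : Matrix (Fin b) (Fin (2 * q)) ℂ) :
    (X ⊗ₖ Y) * pairOp (inputBlock E A) (inputBlock F B) =
      pairOp (inputBlock E (X * A)) (inputBlock F (Y * B)) := by
  rw [kronecker_mul_pairOp]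
  congr 1 <;> funext i <;> rw [inputBlock_mul]

/-- The rank of `block A 0` is that of the local operator for the input state `0`. -/
theorem rank_inputBlock {a p : ℕ} {E : Matrix (Fin p) (Fin 2) ℂ} (A : Matrix (Fin a) (Fin (2 * p)) ℂ)
    (k : Fin 2) (hE : ∃ E' : Matrix (Fin 2) (Fin p) ℂ, E * E' = 1) :
    (inputBlock E A k).rank = (block A k).rank := by
  set A' := A.submatrix id (fun x => finProdFinEquiv (k, x)) with hA'
  have hsub : (Aᴴ * A).submatrix (fun x => finProdFinEquiv (k, x)) (fun x => finProdFinEquiv (k, x))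
      = A'ᴴ * A' := rfl
  have hpos : 0 ≤ A'ᴴ * A' := (posSemidef_conjTranspose_mul_self A').nonneg
  have hS : (block A k)ᴴ * block A k = A'ᴴ * A' := by
    rw [block, hsub]
    have h1 : (CFC.sqrt (A'ᴴ * A'))ᴴ = CFC.sqrt (A'ᴴ * A') :=
      (CFC.sqrt_nonneg (A'ᴴ * A')).isSelfAdjoint
    rw [h1, CFC.sqrt_mul_sqrt_self _ hpos]
  rw [← rank_conjTranspose_mul_self (block A k), hS, rank_conjTranspose_mul_self, inputBlock]
  obtain ⟨E', hE'⟩ := hE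
  refine le_antisymm (rank_mul_le_left _ _) ?_
  calc A'.rank = (A' * E * E').rank := by rw [Matrix.mul_assoc, hE', Matrix.mul_one]
    _ ≤ (A' * E).rank := rank_mul_le_left _ _

theorem exists_right_inverse {E : Matrix (Fin 2) (Fin 2) ℂ} (hE : (Eᴴ * E).det ≠ 0) :
    ∃ E' : Matrix (Fin 2) (Fin 2) ℂ, E * E' = 1 := by
  rw [det_mul] at hE
  exact ⟨E⁻¹, mul_nonsing_inv E (isUnit_iff_ne_zero.2 (right_ne_zero_of_mul hE))⟩

/-- Rescaling of the local Gram matrices rescales `A†A`. -/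
theorem conjTranspose_mul_self_eq_smul {a a' p : ℕ} {E : Matrix (Fin p) (Fin 2) ℂ}
    {E' : Matrix (Fin 2) (Fin p) ℂ} (hE : E * E' = 1) {A : Matrix (Fin a) (Fin (2 * p)) ℂ}
    {A' : Matrix (Fin a') (Fin (2 * p)) ℂ} {l : ℂ}
    (h : ∀ i i', gram (inputBlock E A') i i' = l • gram (inputBlock E A) i i') :
    A'ᴴ * A' = l • (Aᴴ * A) := by
  ext x y
  obtain ⟨⟨i, x⟩, rfl⟩ := finProdFinEquiv.surjective x
  obtain ⟨⟨i', y⟩, rfl⟩ := finProdFinEquiv.surjective y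
  have hent : ∀ {a : ℕ} (A : Matrix (Fin a) (Fin (2 * p)) ℂ),
      (Aᴴ * A) (finProdFinEquiv (i, x)) (finProdFinEquiv (i', y)) =
        (E'ᴴ * gram (inputBlock E A) i i' * E') x y := by
    intro a A
    have : E'ᴴ * gram (inputBlock E A) i i' * E' =
        (A.submatrix id (fun x => finProdFinEquiv (i, x)) * (E * E'))ᴴ *
          (A.submatrix id (fun x => finProdFinEquiv (i', x)) * (E * E')) := by
      simp only [gram, inputBlock, conjTranspose_mul, Matrix.mul_assoc]
    rw [this, hE, Matrix.mul_one, Matrix.mul_one]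
    rfl
  rw [Matrix.smul_apply, hent, hent, h]
  simp

theorem actsAsRandomUnitary_of_gram {r a c : ℕ} {d : Fin r → ℕ}
    {M : ∀ i, Matrix (Fin (d i)) (Fin a) ℂ} {A : Matrix (Fin a) (Fin c) ℂ} {w : Fin r → ℝ}
    (hw : ∀ i, 0 ≤ w i) (hsum : ∑ i, w i = 1)
    (h : ∀ i, (M i * A)ᴴ * (M i * A) = (w i : ℂ) • (Aᴴ * A)) : ActsAsRandomUnitary M A := by
  -- At outcomes with w i = 0 this operator is zero, by the convention 0⁻¹ = 0, and there `M i * A`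
  -- vanishes too.
  refine ⟨w, fun i => ((√(w i))⁻¹ : ℂ) • M i, hw, hsum, fun i => ?_, fun i hi => ?_⟩
  · by_cases hi : w i = 0
    · have := h i
      rw [hi, Complex.ofReal_zero, zero_smul, conjTranspose_mul_self_eq_zero] at this
      simp [this]
    · have : (√(w i) : ℂ) ≠ 0 := by
        exact_mod_cast (Real.sqrt_pos.2 (lt_of_le_of_ne (hw i) (Ne.symm hi))).ne'
      rw [Matrix.smul_mul, smul_smul, mul_inv_cancel₀ this, one_smul]
  · have hc : star ((√(w i))⁻¹ : ℂ) * ((√(w i))⁻¹ : ℂ) * (w i : ℂ) = 1 := by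
      have h1 : star ((√(w i))⁻¹ : ℂ) = ((√(w i))⁻¹ : ℂ) := by simp
      rw [h1, ← mul_inv, ← Complex.ofReal_mul, Real.mul_self_sqrt (hw i), inv_mul_cancel₀]
      exact_mod_cast hi
    rw [Matrix.smul_mul, conjTranspose_smul, Matrix.smul_mul, Matrix.mul_smul, smul_smul, h i,
      smul_smul, hc, one_smul]

theorem Balanced.weight_nonneg {e : ℂ} {w : ℝ} {a b : ℕ}
    {A : Fin 2 → Matrix (Fin a) (Fin 2) ℂ} {B : Fin 2 → Matrix (Fin b) (Fin 2) ℂ}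
    (h : Balanced e w (gram A) (gram B)) : 0 ≤ w := by
  have h1 := h.trace 0 0
  rw [trace_gram_mul_gram] at h1
  have h2 : (0 : ℂ) ≤ w := h1 ▸ (posSemidef_conjTranspose_mul_self _).trace_nonneg
  exact_mod_cast h2

theorem Occurs.weight_ne_zero {p q a b : ℕ} {ψ : EuclideanSpace ℂ (Fin p × Fin q)}
    {E : Matrix (Fin p) (Fin 2) ℂ} {F : Matrix (Fin q) (Fin 2) ℂ}
    (hψ : ∀ k l, ψ (k, l) = ∑ j, E k j * F l j)
    {A : Matrix (Fin a) (Fin (2 * p)) ℂ} {B : Matrix (Fin b) (Fin (2 * q)) ℂ}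
    (ho : Occurs ψ A B) {e : ℂ} {w : ℝ}
    (h : Balanced e w (gram (inputBlock E A)) (gram (inputBlock F B))) : w ≠ 0 := by
  intro hw
  obtain ⟨ρ, -, hne⟩ := ho
  apply hne
  rw [branchState_eq hψ, h.pairOp_eq_zero_of_weight hw]
  simp

section TwoQubitResource

variable {θ w : ℝ} {ψ : EuclideanSpace ℂ (Fin 2 × Fin 2)} {E F : Matrix (Fin 2) (Fin 2) ℂ}
  {n a b r : ℕ} {d : Fin r → ℕ} {A : Matrix (Fin a) (Fin (2 * 2)) ℂ}
  {B : Matrix (Fin b) (Fin (2 * 2)) ℂ}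

/-- The outcome probabilities are the ratios v i / w of branch weights; `Balanced.gram_mul_eq` gives
the rescaling, and the invertibility of `F` transfers it to Bᴴ B. -/
theorem Protocol.Realizes.actsAsRandomUnitary_bob (hθ : Complex.exp (θ * Complex.I) ≠ 1)
    (hψ : ∀ k l, ψ (k, l) = ∑ j, E k j * F l j) (hF : (Fᴴ * F).det ≠ 0)
    {K : ∀ i, Matrix (Fin (d i)) (Fin b) ℂ} {hK : ∑ i, (K i)ᴴ * K i = 1}
    {next : ∀ i, Protocol n a (d i)}
    (h : (Protocol.bob r d K hK next).Realizes (pairOp (inputBlock E A) (inputBlock F B)) (gate θ) w)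
    (hrank : (block B 0).rank = 1) (ho : Occurs ψ A B) : ActsAsRandomUnitary K B := by
  have hU := gate_conjTranspose_mul_self θ
  have he1 := Complex.norm_exp_ofReal_mul_I θ
  have hb := h.balanced hθ
  have hw := ho.weight_ne_zero hψ hb
  obtain ⟨F', hF'⟩ := exists_right_inverse hF
  rw [← rank_inputBlock B 0 ⟨F', hF'⟩] at hrank
  obtain ⟨v, hv, hn⟩ := h.of_bob hU
  simp only [kronecker_mul_pairOp, Matrix.one_mul] at hn
  have hbi := fun i => (hn i).balanced hθ
  refine actsAsRandomUnitary_of_gram (w := fun i => v i / w) (fun i => ?_) ?_ fun i => ?_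
  · exact div_nonneg (hbi i).weight_nonneg hb.weight_nonneg
  · rw [← Finset.sum_div, hv, div_self hw]
  · refine conjTranspose_mul_self_eq_smul hF' fun k k' => ?_
    have := hb.gram_mul_eq (hbi i) hθ he1 hw hrank k k'
    simp only [gram, inputBlock_mul] at this ⊢
    exact this

theorem Protocol.Realizes.actsAsRandomUnitary_alice (hθ : Complex.exp (θ * Complex.I) ≠ 1)
    (hψ : ∀ k l, ψ (k, l) = ∑ j, E k j * F l j) (hE : (Eᴴ * E).det ≠ 0)
    {M : ∀ i, Matrix (Fin (d i)) (Fin a) ℂ} {hM : ∑ i, (M i)ᴴ * M i = 1}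
    {next : ∀ i, Protocol n (d i) b}
    (h : (Protocol.alice r d M hM next).Realizes (pairOp (inputBlock E A) (inputBlock F B))
      (gate θ) w)
    (hrank : (block A 0).rank = 1) (ho : Occurs ψ A B) : ActsAsRandomUnitary M A := by
  have hU := gate_conjTranspose_mul_self θ
  have he1 := Complex.norm_exp_ofReal_mul_I θ
  have hb := h.balanced hθ
  have hw := ho.weight_ne_zero hψ hb
  obtain ⟨E', hE'⟩ := exists_right_inverse hE
  rw [← rank_inputBlock A 0 ⟨E', hE'⟩] at hrank
  obtain ⟨v, hv, hn⟩ := h.of_alice hU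
  simp only [kronecker_mul_pairOp, Matrix.one_mul] at hn
  have hbi := fun i => (hn i).balanced hθ
  refine actsAsRandomUnitary_of_gram (w := fun i => v i / w) (fun i => ?_) ?_ fun i => ?_
  · exact div_nonneg (hbi i).weight_nonneg hb.weight_nonneg
  · rw [← Finset.sum_div, hv, div_self hw]
  · refine conjTranspose_mul_self_eq_smul hE' fun k k' => ?_
    have := hb.symm.gram_mul_eq (hbi i).symm hθ he1 hw hrank k k'
    simp only [gram, inputBlock_mul] at this ⊢
    exact this

end TwoQubitResource

end LOCC

open LOCC in
theorem mainTheorem2 (θ : ℝ) (hθ : Complex.exp (θ * Complex.I) ≠ 1) :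
    -- the last three turns (Bob, Alice, Bob), for a two-qubit resource
    (∀ ψ : EuclideanSpace ℂ (Fin 2 × Fin 2), IsPureStateOfSchmidtNumber 2 ψ →
      ∀ (n : ℕ) (P : Protocol n (2 * 2) (2 * 2)), P.Implements ψ (gate θ) →
      ∀ (a b r : ℕ) (d : Fin r → ℕ) (K : ∀ i, Matrix (Fin (d i)) (Fin b) ℂ)
        (hK : ∑ i, (K i)ᴴ * K i = 1) (next : ∀ i, Protocol 2 a (d i))
        (A : Matrix (Fin a) (Fin (2 * 2)) ℂ) (B : Matrix (Fin b) (Fin (2 * 2)) ℂ),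
        (Protocol.bob r d K hK next).IsNode P A B →
        (Protocol.bob r d K hK next).Follows [Party.bob, Party.alice, Party.bob] →
        ((block A 0).rank = 1 →
          ∀ (i : Fin r) (r' : ℕ) (d' : Fin r' → ℕ) (M : ∀ j, Matrix (Fin (d' j)) (Fin a) ℂ)
            (hM : ∑ j, (M j)ᴴ * M j = 1) (next' : ∀ j, Protocol 1 (d' j) (d i)),
            next i = Protocol.alice r' d' M hM next' → Occurs ψ A (K i * B) →
              ActsAsRandomUnitary M A) ∧
        ((block B 0).rank = 1 → Occurs ψ A B → ActsAsRandomUnitary K B) ∧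
        ((block A 0).rank = 2 → (block B 0).rank = 2 →
          ∃ Q : Protocol 3 a b, Q.Follows [Party.alice, Party.bob, Party.alice] ∧
            ∀ ρ, IsState ρ →
              Q.run (branchState ψ A B ρ) =
                (Protocol.bob r d K hK next).run (branchState ψ A B ρ))) ∧
    -- reduction of the number of turns, for any pure resource of Schmidt number 2
    (∀ (p q : ℕ) (ψ : EuclideanSpace ℂ (Fin p × Fin q)), IsPureStateOfSchmidtNumber 2 ψ →
      ∀ (n : ℕ) (P : Protocol n (2 * p) (2 * q)), P.Implements ψ (gate θ) →
        (3 < n → ∃ P' : Protocol (n - 1) (2 * p) (2 * q),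
          P'.SameFirst (n - 4) P ∧ P'.Implements ψ (gate θ)) ∧
        ∃ P' : Protocol 3 (2 * p) (2 * q),
          (P'.Follows [Party.alice, Party.bob, Party.alice] ∨
            P'.Follows [Party.bob, Party.alice, Party.bob]) ∧
          P'.Implements ψ (gate θ)) := by
  have hU := gate_conjTranspose_mul_self θ
  refine ⟨fun ψ hS n P hP a b r d K hK next A B hN _ => ?_, fun p q ψ hS n P hP => ?_⟩
  · obtain ⟨E, F, hψ, hE, hF⟩ := hS.exists_factorization
    obtain ⟨w, hw⟩ := Protocol.Realizes.of_isNode hN hU ((Protocol.implements_iff hψ).1 hP)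
    rw [kronecker_mul_pairOp_inputBlock, Matrix.mul_one, Matrix.mul_one] at hw
    refine ⟨fun hrank i r' d' M hM next' hnext ho => ?_, fun hrank ho => ?_, fun _ _ => ?_⟩
    · obtain ⟨v, -, hv⟩ := hw.of_bob hU
      have hi := hv i
      rw [kronecker_mul_pairOp_inputBlock, Matrix.one_mul, hnext] at hi
      exact hi.actsAsRandomUnitary_alice hθ hψ hE hrank ho
    · exact hw.actsAsRandomUnitary_bob hθ hψ hF hrank ho
    · obtain ⟨Q, hQ, hr⟩ := hw.exists_alice_bob_alice hθ
      refine ⟨Q, hQ, fun ρ hρ => ?_⟩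
      rw [branchState_eq hψ, hr ρ hρ, hw ρ hρ]
  · obtain ⟨E, F, hψ, -, -⟩ := hS.exists_factorization
    have hR := (Protocol.implements_iff hψ).1 hP
    refine ⟨fun hn => ?_, ?_⟩
    · obtain ⟨k, rfl⟩ : ∃ k, n = 4 + k := ⟨n - 4, by omega⟩
      rw [show 4 + k - 1 = 3 + k by omega, show 4 + k - 4 = k by omega]
      -- The property carried along the tree is that the branch operator has the form `pairOp`;
      -- local operators preserve it.
      obtain ⟨P', hf, hr⟩ := exists_sameFirst (m := 4) (m' := 3) hU
        (fun {a b} V => ∃ A B, V = pairOp A B)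
        (by
          rintro a b a' b' X Y _ ⟨A, B, rfl⟩
          exact ⟨_, _, kronecker_mul_pairOp X Y A B⟩)
        (by
          rintro a b Q _ w ⟨A, B, rfl⟩ h
          obtain ⟨Q', -, hQ'⟩ := h.exists_alice_bob_alice hθ
          exact ⟨Q', hQ'⟩) k P _ 1 ⟨_, _, rfl⟩ hR
      exact ⟨P', hf, (Protocol.implements_iff hψ).2 hr⟩
    · obtain ⟨P', hf, hr⟩ := hR.exists_alice_bob_alice hθ
      exact ⟨P', Or.inl hf, (Protocol.implements_iff hψ).2 hr⟩
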